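/- Let $r \ge 1$ be an integer. Let $\mathsf{Kostka}_r^{\mathbb Z}$ be the set of pairs $(\lambda,\mu) \in \mathbb{Z}^r \times \mathbb{Z}^r$ such that $\lambda_1 \ge \lambda_2 \ge \cdots \ge \lambda_r \ge 0$, $\mu_1 \ge \mu_2 \ge \cdots \ge \mu_r \ge 0$, $\sum_{i=1}^t \lambda_i \ge \sum_{i=1}^t \mu_i$ for $1 \le t \le r-1$, and $\sum_{i=1}^r \lambda_i = \sum_{i=1}^r \mu_i$; these are the lattice points of the Kostka cone in $\mathbb{R}^{2r}$, defined by the same conditions on real vectors, and they form a semigroup under addition. Its (unique minimal) Hilbert basis consists of its irreducible elements, i.e. the nonzero elements that are not the sum of two nonzero elements of $\mathsf{Kostka}_r^{\mathbb Z}$. A partition is called a rectangle if all its nonzero parts are equal. **Theorem (Width Bound).** Suppose $(\lambda,\mu)$ is a Hilbert basis element of $\mathsf{Kostka}_r^{\mathbb Z}$. Then $\lambda_1 \le r$. Moreover, if $\lambda_1 = r$, then $\lambda$ and $\mu$ are both rectangles. -/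

import Mathlib

/-- The Kostka cone in `ℝ^{2r}`: pairs of weakly decreasing nonnegative real vectors
`(λ, μ)` of length `r`, with the same sum, such that every partial sum of `λ` is at least
the corresponding partial sum of `μ`. (`∑ i ∈ Finset.Iic t` is the sum of the entries up to and
including position `t`; the inequality for the last `t` is implied by the equality of the sums.) -/
def kostkaCone (r : ℕ) : Set ((Fin r → ℝ) × (Fin r → ℝ)) :=
  {p | Antitone p.1 ∧ (∀ i, 0 ≤ p.1 i) ∧
       Antitone p.2 ∧ (∀ i, 0 ≤ p.2 i) ∧
       (∀ t : Fin r, ∑ i ∈ Finset.Iic t, p.2 i ≤ ∑ i ∈ Finset.Iic t, p.1 i) ∧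
       ∑ i, p.1 i = ∑ i, p.2 i}

/-- The Kostka semigroup: the lattice points of the Kostka cone. -/
def kostkaSemigroup (r : ℕ) : AddSubmonoid ((Fin r → ℤ) × (Fin r → ℤ)) where
  carrier := {p |
    ((fun i => (p.1 i : ℝ), fun i => (p.2 i : ℝ)) : (Fin r → ℝ) × (Fin r → ℝ)) ∈ kostkaCone r}
  zero_mem' := by simp [kostkaCone, Antitone]
  add_mem' := by
    rintro p q ⟨h1, h2, h3, h4, h5, h6⟩ ⟨k1, k2, k3, k4, k5, k6⟩
    refine ⟨?_, ?_, ?_, ?_, ?_, ?_⟩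
    · intro i j hij
      simpa using add_le_add (h1 hij) (k1 hij)
    · intro i
      simpa using add_nonneg (h2 i) (k2 i)
    · intro i j hij
      simpa using add_le_add (h3 hij) (k3 hij)
    · intro i
      simpa using add_nonneg (h4 i) (k4 i)
    · intro t
      simpa [Finset.sum_add_distrib] using add_le_add (h5 t) (k5 t)
    · simpa [Finset.sum_add_distrib] using congrArg₂ (· + ·) h6 k6

/-- The Kostka semigroup is pointed. -/
theorem kostkaSemigroup_pointed (r : ℕ) (x : (Fin r → ℤ) × (Fin r → ℤ))
    (hx : x ∈ kostkaSemigroup r) (hx' : -x ∈ kostkaSemigroup r) : x = 0 := by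
  obtain ⟨_, h2, _, h4, _, _⟩ := hx
  obtain ⟨_, k2, _, k4, _, _⟩ := hx'
  refine Prod.ext (funext fun i => ?_) (funext fun i => ?_)
  · have h := h2 i
    have k := k2 i
    simp at h k
    exact le_antisymm k h
  · have h := h4 i
    have k := k4 i
    simp at h k
    exact le_antisymm k h

/-- The irreducible elements of a semigroup `S` of lattice points: the nonzero elements of `S`
that are not the sum of two nonzero elements of `S`. When `S` is the set of lattice points of a
pointed rational cone, this is its unique minimal Hilbert basis; see
`eq_hilbertBasis_of_minimal` and `hilbertBasis_subset` for the characterization. -/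
def hilbertBasis {M : Type*} [AddCommGroup M] (S : AddSubmonoid M) : Set M :=
  {a | a ∈ S ∧ a ≠ 0 ∧ ¬ ∃ b ∈ S, ∃ c ∈ S, b ≠ 0 ∧ c ≠ 0 ∧ a = b + c}

/-- A partition is a rectangle if all of its nonzero parts are equal. -/
def IsRectangle {r : ℕ} (ν : Fin r → ℤ) : Prop :=
  ∀ i j, ν i ≠ 0 → ν j ≠ 0 → ν i = ν j

/-- A Hilbert basis (not necessarily minimal): a finite subset of `S` such that every element of
`S` is a nonnegative integral combination of it. -/
def IsHilbertBasis {M : Type*} [AddCommGroup M] (S : AddSubmonoid M) (H : Set M) : Prop :=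
  H.Finite ∧ H ⊆ (S : Set M) ∧ ∀ a ∈ S, a ∈ AddSubmonoid.closure H

/-- Every Hilbert basis contains all irreducible elements. -/
theorem hilbertBasis_subset {M : Type*} [AddCommGroup M] (S : AddSubmonoid M) (H : Set M)
    (hH : IsHilbertBasis S H) : hilbertBasis S ⊆ H := by
  rintro a ⟨haS, ha0, hirr⟩
  have hle : AddSubmonoid.closure H ≤ S := AddSubmonoid.closure_le.2 hH.2.1
  have key : ∀ x ∈ AddSubmonoid.closure H,
      x = 0 ∨ x ∈ H ∨ ∃ b ∈ S, ∃ c ∈ S, b ≠ 0 ∧ c ≠ 0 ∧ x = b + c := by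
    intro x hx
    induction hx using AddSubmonoid.closure_induction with
    | mem x hx => exact Or.inr (Or.inl hx)
    | zero => exact Or.inl rfl
    | add x y hx hy ihx ihy =>
      by_cases hx0 : x = 0
      · simpa [hx0] using ihy
      by_cases hy0 : y = 0
      · simpa [hy0] using ihx
      exact Or.inr (Or.inr ⟨x, hle hx, y, hle hy, hx0, hy0, rfl⟩)
  rcases key a (hH.2.2 a haS) with h | h | h
  · exact absurd h ha0
  · exact h
  · exact absurd h hirr

/-- In a pointed semigroup, a minimal Hilbert basis consists of exactly the irreducible
elements. -/
theorem eq_hilbertBasis_of_minimal {M : Type*} [AddCommGroup M] (S : AddSubmonoid M)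
    (hS : ∀ x ∈ S, -x ∈ S → x = 0) (H : Set M)
    (hH : Minimal (IsHilbertBasis S) H) : H = hilbertBasis S := by
  refine Set.Subset.antisymm ?_ (hilbertBasis_subset S H hH.prop)
  intro h hh
  have hle : AddSubmonoid.closure H ≤ S := AddSubmonoid.closure_le.2 hH.prop.2.1
  have hle' : AddSubmonoid.closure (H \ {h}) ≤ S :=
    (AddSubmonoid.closure_mono Set.sdiff_subset).trans hle
  have hhS : h ∈ S := hH.prop.2.1 hh
  have hnot : h ∉ AddSubmonoid.closure (H \ {h}) := by
    intro hcl
    have hgen : AddSubmonoid.closure H ≤ AddSubmonoid.closure (H \ {h}) := by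
      refine AddSubmonoid.closure_le.2 fun x hx => ?_
      by_cases hxh : x = h
      · exact hxh ▸ hcl
      · exact AddSubmonoid.subset_closure ⟨hx, hxh⟩
    have hB : IsHilbertBasis S (H \ {h}) :=
      ⟨hH.prop.1.subset Set.sdiff_subset, Set.sdiff_subset.trans hH.prop.2.1,
        fun a ha => hgen (hH.prop.2.2 a ha)⟩
    exact (hH.le_of_le hB Set.sdiff_subset hh).2 rfl
  have hdec : ∀ x ∈ S, ∃ n : ℕ, ∃ y ∈ AddSubmonoid.closure (H \ {h}), x = n • h + y := by
    intro x hx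
    have hx' := hH.prop.2.2 x hx
    rw [← Set.insert_sdiff_self_of_mem hh, Set.insert_eq, AddSubmonoid.closure_union,
      AddSubmonoid.mem_sup] at hx'
    obtain ⟨y, hy, z, hz, rfl⟩ := hx'
    obtain ⟨n, rfl⟩ := AddSubmonoid.mem_closure_singleton.1 hy
    exact ⟨n, z, hz, rfl⟩
  have aux : ∀ b ∈ S, ∀ c ∈ S, c ≠ 0 → h = b + c → b ∈ AddSubmonoid.closure (H \ {h}) := by
    intro b hb c hc hc0 hbc
    obtain ⟨n, y, hy, hby⟩ := hdec b hb
    cases n with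
    | zero => simpa [hby] using hy
    | succ n =>
      refine absurd (hS c hc ?_) hc0
      have hneg : -c = n • h + y := by
        have h2 : h = (n • h + h + y) + c := by rw [← succ_nsmul, ← hby]; exact hbc
        have h3 : (n • h + y) + c = 0 := by
          have h4 : h + ((n • h + y) + c) = h + 0 := by
            rw [add_zero]; nth_rewrite 3 [h2]; abel
          exact add_left_cancel h4
        exact (eq_neg_of_add_eq_zero_left h3).symm
      rw [hneg]
      exact S.add_mem (S.nsmul_mem hhS n) (hle' hy)
  refine ⟨hhS, ?_, ?_⟩
  · rintro rfl
    exact hnot (zero_mem _)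
  · rintro ⟨b, hb, c, hc, hb0, hc0, hbc⟩
    have hsum := add_mem (aux b hb c hc hc0 hbc) (aux c hc b hb hb0 (hbc.trans (add_comm b c)))
    rw [← hbc] at hsum
    exact hnot hsum

/-! Cut `lam` and `mu` into columns and pair the `k`-th column of `lam`, of height `a k`, with that
of `mu`, of height `b k`; there are as many pairs as the first part of `lam`. A set of column pairs
again gives two partitions, so irreducibility says that the pairs cannot be split into two nonempty
classes that both satisfy dominance and equality of sizes. If `a k = b k` for some `k`, that pair
splits off and must be the only one. Otherwise the rows between `a k` and `b k` lie in one run of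
rows where `lam - mu` has constant nonzero sign. Give the pair the weight `a k - b k` and the start
of its run as index: dominance then says that all prefix sums of the weights are nonnegative
(`ColumnPairs.irreducibleSystem`). A weight is at most the length of its run in absolute value, and
these lengths add up to at most `r`.

It remains to bound the size of an irreducible signed system (`IrreducibleSystem.card_le`). For one
positive index `l` followed by one negative index `j`, add elements one by one, a negative one when
the current sum is positive and a positive one otherwise. A repeated sum would cut out a balanced
set with balanced complement, so the nonzero sums are distinct elements of `[-c j, c l]`, and zero
is reached only when everything is used: at most `c l + c j + 1` elements. In general this is done
on adjacent intervals of indices. When one side runs out, the values recorded on its side are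
charged to its `c`, and the merged interval behaves like a single index (`PosItem.merge`); a stack
of positive items organizes the merges.

Lowering the bound by one wherever some weight is below the run length absorbs the `+ 1`
(`IrreducibleSystem.card_le_sum`). Equality allows only one lowered index; with the mirrored
statement this leaves one positive and one negative run, each filled by every one of its column
pairs, and so forces rectangles. -/

section SignedSystems

set_option linter.unusedSectionVars false

variable {ι : Type*} [DecidableEq ι]

/-! ### Signed systems and balanced sets -/

/-- The sum of the weights of the elements of `T` whose index is less than `i`. -/
def prefixSum (w : ι → ℤ) (idx : ι → ℕ) (i : ℕ) (T : Finset ι) : ℤ :=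
  ∑ e ∈ T, if idx e < i then w e else 0

/-- The sum of the weights of the elements of `T` whose index is at least `i`. -/
def suffixSum (w : ι → ℤ) (idx : ι → ℕ) (i : ℕ) (T : Finset ι) : ℤ :=
  ∑ e ∈ T, if idx e < i then 0 else w e

/-- A set of weighted elements is balanced if its total weight is zero and all its prefix sums
are nonnegative. -/
def IsBalanced (w : ι → ℤ) (idx : ι → ℕ) (T : Finset ι) : Prop :=
  ∑ e ∈ T, w e = 0 ∧ ∀ i, 0 ≤ prefixSum w idx i T

/-- A balanced set `E` of weighted elements that is not a disjoint union of two nonempty balanced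
sets, where the elements of index `i` have the same sign, and where `c` bounds the weights. -/
structure IrreducibleSystem (E : Finset ι) (w : ι → ℤ) (idx : ι → ℕ) (pos : ℕ → Prop)
    (c : ℕ → ℕ) (K : ℕ) : Prop where
  idx_lt : ∀ e ∈ E, idx e < K
  balanced : IsBalanced w idx E
  irreducible : ∀ T ⊆ E, IsBalanced w idx T → IsBalanced w idx (E \ T) → T = ∅ ∨ T = E
  weight_pos : ∀ e ∈ E, pos (idx e) → 0 < w e
  weight_neg : ∀ e ∈ E, ¬ pos (idx e) → w e < 0
  weight_le : ∀ e ∈ E, |w e| ≤ c (idx e) + 1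
  exists_weight_le : ∀ e ∈ E, pos (idx e) → ∃ e' ∈ E, idx e' = idx e ∧ w e' ≤ c (idx e)

variable {E : Finset ι} {w : ι → ℤ} {idx : ι → ℕ} {pos : ℕ → Prop} {c : ℕ → ℕ} {K : ℕ}

theorem prefixSum_add_suffixSum (i : ℕ) (T : Finset ι) :
    prefixSum w idx i T + suffixSum w idx i T = ∑ e ∈ T, w e := by
  rw [prefixSum, suffixSum, ← Finset.sum_add_distrib]
  exact Finset.sum_congr rfl fun e _ => by split_ifs <;> simp

theorem prefixSum_sdiff (i : ℕ) {S T : Finset ι} (h : S ⊆ T) :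
    prefixSum w idx i (T \ S) = prefixSum w idx i T - prefixSum w idx i S :=
  eq_sub_of_add_eq (Finset.sum_sdiff h)

theorem suffixSum_sdiff (i : ℕ) {S T : Finset ι} (h : S ⊆ T) :
    suffixSum w idx i (T \ S) = suffixSum w idx i T - suffixSum w idx i S :=
  eq_sub_of_add_eq (Finset.sum_sdiff h)

theorem weightSum_sdiff {S T : Finset ι} (h : S ⊆ T) :
    ∑ e ∈ T \ S, w e = ∑ e ∈ T, w e - ∑ e ∈ S, w e :=
  eq_sub_of_add_eq (Finset.sum_sdiff h)

theorem prefixSum_eq_zero {i : ℕ} {S : Finset ι} (h : ∀ e ∈ S, i ≤ idx e) :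
    prefixSum w idx i S = 0 :=
  Finset.sum_eq_zero fun e he => if_neg (not_lt.2 (h e he))

theorem suffixSum_eq_zero {i : ℕ} {S : Finset ι} (h : ∀ e ∈ S, idx e < i) :
    suffixSum w idx i S = 0 :=
  Finset.sum_eq_zero fun e he => if_pos (h e he)

/-! ### Recorded partial sums and partly consumed intervals -/

/-- Values attained by a growing set whose remaining positive elements have index `l`. -/
def PosHistory (w : ι → ℤ) (idx : ι → ℕ) (c : ℕ → ℕ) (l : ℕ) (S : Finset ι) (H : Finset ℤ) :
    Prop :=
  ∀ h ∈ H, 1 ≤ h ∧ h ≤ c l ∧ ∃ S' ⊆ S, ∑ e ∈ S', w e = h ∧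
    ∀ i, l < i → suffixSum w idx i S ≤ suffixSum w idx i S' ∧ suffixSum w idx i S' ≤ 0

/-- Values attained by a growing set whose remaining negative elements have index `j`. -/
def NegHistory (w : ι → ℤ) (idx : ι → ℕ) (c : ℕ → ℕ) (j : ℕ) (S : Finset ι) (H : Finset ℤ) :
    Prop :=
  ∀ h ∈ H, -(c j : ℤ) ≤ h ∧ h ≤ -1 ∧ ∃ S' ⊆ S, ∑ e ∈ S', w e = h ∧
    ∀ i, i ≤ j → prefixSum w idx i S' ≤ prefixSum w idx i S ∧ 0 ≤ prefixSum w idx i S'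

theorem PosHistory.card_le {l : ℕ} {S : Finset ι} {H : Finset ℤ}
    (h : PosHistory w idx c l S H) : H.card ≤ c l := by
  have hsub : H ⊆ Finset.Icc (1 : ℤ) (c l) := fun x hx =>
    Finset.mem_Icc.2 ⟨(h x hx).1, (h x hx).2.1⟩
  simpa using Finset.card_le_card hsub

theorem NegHistory.card_le {j : ℕ} {S : Finset ι} {H : Finset ℤ}
    (h : NegHistory w idx c j S H) : H.card ≤ c j := by
  have hsub : H ⊆ Finset.Icc (-(c j : ℤ)) (-1) := fun x hx =>
    Finset.mem_Icc.2 ⟨(h x hx).1, (h x hx).2.1⟩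
  simpa using Finset.card_le_card hsub

/-- Old witnesses survive because the suffix sums beyond `l` only decrease as the set grows; this
lets histories be carried through merges. -/
theorem PosHistory.mono {l : ℕ} {S T : Finset ι} {H : Finset ℤ}
    (h : PosHistory w idx c l S H) (hST : S ⊆ T)
    (hsuf : ∀ i, l < i → suffixSum w idx i T ≤ suffixSum w idx i S) :
    PosHistory w idx c l T H := by
  intro x hx
  obtain ⟨h1, h2, S', hS', hsum, hi⟩ := h x hx
  exact ⟨h1, h2, S', hS'.trans hST, hsum, fun i hli =>
    ⟨(hsuf i hli).trans (hi i hli).1, (hi i hli).2⟩⟩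

theorem NegHistory.mono {j : ℕ} {S T : Finset ι} {H : Finset ℤ}
    (h : NegHistory w idx c j S H) (hST : S ⊆ T)
    (hpre : ∀ i, i ≤ j → prefixSum w idx i S ≤ prefixSum w idx i T) :
    NegHistory w idx c j T H := by
  intro x hx
  obtain ⟨h1, h2, S', hS', hsum, hi⟩ := h x hx
  exact ⟨h1, h2, S', hS'.trans hST, hsum, fun i hij =>
    ⟨(hi i hij).1.trans (hpre i hij), (hi i hij).2⟩⟩

theorem PosHistory.insert {l : ℕ} {S : Finset ι} {H : Finset ℤ} (h : PosHistory w idx c l S H)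
    (h1 : 1 ≤ ∑ e ∈ S, w e) (h2 : ∑ e ∈ S, w e ≤ c l)
    (hsuf : ∀ i, l < i → suffixSum w idx i S ≤ 0) :
    PosHistory w idx c l S (insert (∑ e ∈ S, w e) H) := by
  intro x hx
  rcases Finset.mem_insert.1 hx with rfl | hx
  · exact ⟨h1, h2, S, subset_rfl, rfl, fun i hi => ⟨le_rfl, hsuf i hi⟩⟩
  · exact h x hx

theorem NegHistory.insert {j : ℕ} {S : Finset ι} {H : Finset ℤ} (h : NegHistory w idx c j S H)
    (h1 : -(c j : ℤ) ≤ ∑ e ∈ S, w e) (h2 : ∑ e ∈ S, w e ≤ -1)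
    (hpre : ∀ i, i ≤ j → 0 ≤ prefixSum w idx i S) :
    NegHistory w idx c j S (insert (∑ e ∈ S, w e) H) := by
  intro x hx
  rcases Finset.mem_insert.1 hx with rfl | hx
  · exact ⟨h1, h2, S, subset_rfl, rfl, fun i hi => ⟨le_rfl, hpre i hi⟩⟩
  · exact h x hx

/-- The elements with indices in `[l, j]` have been used up, except for some positive elements
of index `l`. -/
def PosItem (E : Finset ι) (w : ι → ℤ) (idx : ι → ℕ) (pos : ℕ → Prop) (c : ℕ → ℕ) (l j : ℕ) :
    Prop :=
  l ≤ j ∧ ∃ S ⊆ E, ∃ H, (∀ e ∈ S, l ≤ idx e ∧ idx e ≤ j) ∧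
    (∀ e ∈ E, l ≤ idx e → idx e ≤ j → e ∉ S → idx e = l ∧ pos l) ∧
    0 ≤ ∑ e ∈ S, w e ∧ ∑ e ∈ S, w e ≤ c l ∧ (∀ i, l < i → suffixSum w idx i S ≤ 0) ∧
    PosHistory w idx c l S H ∧ S.card ≤ H.card + ∑ i ∈ Finset.Ioc l j, c i

/-- The elements with indices in `[l, j]` have been used up, except for some negative elements
of index `j`. -/
def NegItem (E : Finset ι) (w : ι → ℤ) (idx : ι → ℕ) (pos : ℕ → Prop) (c : ℕ → ℕ) (l j : ℕ) :
    Prop :=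
  l ≤ j ∧ ∃ S ⊆ E, ∃ H, (∀ e ∈ S, l ≤ idx e ∧ idx e ≤ j) ∧
    (∀ e ∈ E, l ≤ idx e → idx e ≤ j → e ∉ S → idx e = j ∧ ¬ pos j) ∧
    -(c j : ℤ) ≤ ∑ e ∈ S, w e ∧ ∑ e ∈ S, w e ≤ 0 ∧ (∀ i, i ≤ j → 0 ≤ prefixSum w idx i S) ∧
    NegHistory w idx c j S H ∧ S.card ≤ H.card + ∑ i ∈ Finset.Ico l j, c i

/-- An intermediate state in merging a positive item with a negative item to its right. -/
structure MergeState (E : Finset ι) (w : ι → ℤ) (idx : ι → ℕ) (pos : ℕ → Prop) (c : ℕ → ℕ)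
    (l j : ℕ) (S : Finset ι) (H G : Finset ℤ) : Prop where
  lt : l < j
  subset : S ⊆ E
  mem_idx : ∀ e ∈ S, l ≤ idx e ∧ idx e ≤ j
  rest : ∀ e ∈ E, l ≤ idx e → idx e ≤ j → e ∉ S → idx e = l ∧ pos l ∨ idx e = j ∧ ¬ pos j
  le_sum : -(c j : ℤ) ≤ ∑ e ∈ S, w e
  sum_le : ∑ e ∈ S, w e ≤ c l
  prefix_nonneg : ∀ i, l < i → i ≤ j → 0 ≤ prefixSum w idx i S
  suffix_nonpos : ∀ i, l < i → i ≤ j → suffixSum w idx i S ≤ 0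
  posHistory : PosHistory w idx c l S H
  negHistory : NegHistory w idx c j S G

/-! ### Greedy merging of two intervals -/

namespace MergeState

variable {l j : ℕ} {S : Finset ι} {H G : Finset ℤ}

theorem suffix_nonpos' (h : MergeState E w idx pos c l j S H G) (i : ℕ) (hi : l < i) :
    suffixSum w idx i S ≤ 0 := by
  rcases le_or_gt i j with hij | hij
  · exact h.suffix_nonpos i hi hij
  · exact (suffixSum_eq_zero fun e he => (h.mem_idx e he).2.trans_lt hij).le

theorem prefix_nonneg' (h : MergeState E w idx pos c l j S H G) (i : ℕ) (hi : i ≤ j) :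
    0 ≤ prefixSum w idx i S := by
  rcases lt_or_ge l i with hli | hli
  · exact h.prefix_nonneg i hli hi
  · exact (prefixSum_eq_zero fun e he => hli.trans (h.mem_idx e he).1).ge

/-- Beyond `j` the complement of `S` coincides with the balanced set `E`; between `l` and `j` it has
only negative elements, of index `j`, which lower the suffix sum further. -/
theorem rest_suffix_nonpos (h : MergeState E w idx pos c l j S H G)
    (hE : IrreducibleSystem E w idx pos c K) (i : ℕ) (hi : l < i) :
    suffixSum w idx i (E \ S) ≤ 0 := by
  have hE' : ∀ k, suffixSum w idx k E ≤ 0 := fun k => by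
    have h1 := prefixSum_add_suffixSum (w := w) (idx := idx) k E
    have h2 := hE.balanced.2 k
    rw [hE.balanced.1] at h1
    linarith
  have key : suffixSum w idx (max i (j + 1)) (E \ S) ≤ 0 := by
    rw [suffixSum_sdiff _ h.subset,
      suffixSum_eq_zero (S := S) fun e he => lt_max_of_lt_right (by have := h.mem_idx e he; omega)]
    simpa using hE' _
  refine le_trans (Finset.sum_le_sum fun e he => ?_) key
  obtain ⟨heE, heS⟩ := Finset.mem_sdiff.1 he
  split_ifs with h1 h2 h2
  · exact le_rfl
  · exact absurd (lt_max_of_lt_left h1) h2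
  · rcases h.rest e heE (by omega) (by omega) heS with h3 | h3
    · omega
    · exact (hE.weight_neg e heE (h3.1.symm ▸ h3.2)).le
  · exact le_rfl

theorem rest_prefix_nonneg (h : MergeState E w idx pos c l j S H G)
    (hE : IrreducibleSystem E w idx pos c K) (i : ℕ) (hi : i ≤ j) :
    0 ≤ prefixSum w idx i (E \ S) := by
  have key : 0 ≤ prefixSum w idx (min i l) (E \ S) := by
    rw [prefixSum_sdiff _ h.subset,
      prefixSum_eq_zero (S := S) fun e he => (min_le_right i l).trans (h.mem_idx e he).1]
    simpa using hE.balanced.2 _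
  refine le_trans key (Finset.sum_le_sum fun e he => ?_)
  obtain ⟨heE, heS⟩ := Finset.mem_sdiff.1 he
  split_ifs with h1 h2 h2
  · exact le_rfl
  · omega
  · rcases h.rest e heE (by omega) (by omega) heS with h3 | h3
    · exact (hE.weight_pos e heE (h3.1.symm ▸ h3.2)).le
    · omega
  · exact le_rfl

theorem isBalanced_of_sum_eq_zero (h : MergeState E w idx pos c l j S H G)
    (hS : ∑ e ∈ S, w e = 0) : IsBalanced w idx S := by
  refine ⟨hS, fun i => ?_⟩
  rcases le_or_gt i j with hij | hij
  · exact h.prefix_nonneg' i hij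
  · have h1 := prefixSum_add_suffixSum (w := w) (idx := idx) i S
    have h2 := h.suffix_nonpos' i (h.lt.trans hij)
    linarith

/-- At sum zero both `S` and its complement are balanced, so irreducibility applies. -/
theorem eq_of_sum_eq_zero (h : MergeState E w idx pos c l j S H G)
    (hE : IrreducibleSystem E w idx pos c K) (hS : ∑ e ∈ S, w e = 0) (hne : S.Nonempty) :
    S = E := by
  have hsum : ∑ e ∈ E \ S, w e = 0 := by
    rw [weightSum_sdiff h.subset, hE.balanced.1, hS, sub_zero]
  refine (hE.irreducible S h.subset (h.isBalanced_of_sum_eq_zero hS) ⟨hsum, fun i => ?_⟩).resolve_left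
    hne.ne_empty
  rcases le_or_gt i j with hij | hij
  · exact h.rest_prefix_nonneg hE i hij
  · have h1 := prefixSum_add_suffixSum (w := w) (idx := idx) i (E \ S)
    have h2 := h.rest_suffix_nonpos hE i (h.lt.trans hij)
    linarith

/-- No positive value recurs: the elements added between two stages of equal sum form a balanced
set, and the comparison of suffix sums makes its complement balanced too. -/
theorem not_posHistory (h : MergeState E w idx pos c l j S H G)
    (hE : IrreducibleSystem E w idx pos c K) {S' : Finset ι} (hS' : S' ⊂ S)
    (hsum : ∑ e ∈ S', w e = ∑ e ∈ S, w e) (hpos : 0 < ∑ e ∈ S, w e)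
    (hsuf : ∀ i, l < i → suffixSum w idx i S ≤ suffixSum w idx i S' ∧
      suffixSum w idx i S' ≤ 0) : False := by
  have hT : ∑ e ∈ S \ S', w e = 0 := by rw [weightSum_sdiff hS'.1, hsum, sub_self]
  have hTE : S \ S' ⊆ E := Finset.sdiff_subset.trans h.subset
  have hT' : ∑ e ∈ E \ (S \ S'), w e = 0 := by
    rw [weightSum_sdiff hTE, hT, hE.balanced.1, sub_zero]
  have hle : ∀ i, i ≤ l → prefixSum w idx i (S \ S') = 0 := fun i hi =>
    prefixSum_eq_zero fun e he => hi.trans (h.mem_idx e (Finset.sdiff_subset he)).1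
  refine Or.elim (hE.irreducible (S \ S') hTE ⟨hT, fun i => ?_⟩ ⟨hT', fun i => ?_⟩)
    (fun h1 => hS'.2 (Finset.sdiff_eq_empty_iff_subset.1 h1)) fun h1 => ?_
  · rcases le_or_gt i l with hi | hi
    · exact (hle i hi).ge
    · have h1 := prefixSum_add_suffixSum (w := w) (idx := idx) i (S \ S')
      rw [suffixSum_sdiff _ hS'.1] at h1
      have := hsuf i hi
      linarith
  · rcases le_or_gt i l with hi | hi
    · rw [prefixSum_sdiff _ hTE, hle i hi, sub_zero]
      exact hE.balanced.2 i
    · have h1 := prefixSum_add_suffixSum (w := w) (idx := idx) i (E \ (S \ S'))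
      rw [suffixSum_sdiff _ hTE, suffixSum_sdiff _ hS'.1] at h1
      have h2 := h.rest_suffix_nonpos hE i hi
      rw [suffixSum_sdiff _ h.subset] at h2
      have := hsuf i hi
      linarith
  -- If the difference were all of `E`, the earlier stage would be empty, with sum zero.
  · have hdis : Disjoint S' (S \ S') := Finset.disjoint_sdiff
    have : S' = ∅ := by
      rw [h1] at hdis
      exact Finset.disjoint_self_iff_empty _ |>.1 (hdis.mono_right (hS'.1.trans h.subset))
    rw [this, Finset.sum_empty] at hsum
    omega

theorem not_negHistory (h : MergeState E w idx pos c l j S H G)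
    (hE : IrreducibleSystem E w idx pos c K) {S' : Finset ι} (hS' : S' ⊂ S)
    (hsum : ∑ e ∈ S', w e = ∑ e ∈ S, w e) (hneg : ∑ e ∈ S, w e < 0)
    (hpre : ∀ i, i ≤ j → prefixSum w idx i S' ≤ prefixSum w idx i S ∧
      0 ≤ prefixSum w idx i S') : False := by
  have hT : ∑ e ∈ S \ S', w e = 0 := by rw [weightSum_sdiff hS'.1, hsum, sub_self]
  have hTE : S \ S' ⊆ E := Finset.sdiff_subset.trans h.subset
  have hT' : ∑ e ∈ E \ (S \ S'), w e = 0 := by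
    rw [weightSum_sdiff hTE, hT, hE.balanced.1, sub_zero]
  have hgt : ∀ i, j < i → prefixSum w idx i (S \ S') = 0 := fun i hi => by
    have h1 := prefixSum_add_suffixSum (w := w) (idx := idx) i (S \ S')
    rwa [suffixSum_eq_zero fun e he =>
      (h.mem_idx e (Finset.sdiff_subset he)).2.trans_lt hi, hT, add_zero] at h1
  refine Or.elim (hE.irreducible (S \ S') hTE ⟨hT, fun i => ?_⟩ ⟨hT', fun i => ?_⟩)
    (fun h1 => hS'.2 (Finset.sdiff_eq_empty_iff_subset.1 h1)) fun h1 => ?_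
  · rcases le_or_gt i j with hi | hi
    · rw [prefixSum_sdiff _ hS'.1]
      exact sub_nonneg.2 (hpre i hi).1
    · exact (hgt i hi).ge
  · rcases le_or_gt i j with hi | hi
    · rw [prefixSum_sdiff _ hTE, prefixSum_sdiff _ hS'.1]
      have h2 := h.rest_prefix_nonneg hE i hi
      rw [prefixSum_sdiff _ h.subset] at h2
      have := hpre i hi
      linarith
    · rw [prefixSum_sdiff _ hTE, hgt i hi, sub_zero]
      exact hE.balanced.2 i
  · have hdis : Disjoint S' (S \ S') := Finset.disjoint_sdiff
    have : S' = ∅ := by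
      rw [h1] at hdis
      exact Finset.disjoint_self_iff_empty _ |>.1 (hdis.mono_right (hS'.1.trans h.subset))
    rw [this, Finset.sum_empty] at hsum
    omega

theorem card_add_card_le (h : MergeState E w idx pos c l j S H G) (hj : j < K) :
    H.card + G.card + ∑ i ∈ Finset.Ioo l j, c i ≤ ∑ i ∈ Finset.range K, c i := by
  have h1 := h.posHistory.card_le
  have h2 := h.negHistory.card_le
  have h3 : ∑ i ∈ insert l (insert j (Finset.Ioo l j)), c i ≤ ∑ i ∈ Finset.range K, c i := by
    refine Finset.sum_le_sum_of_subset fun i hi => ?_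
    have := h.lt
    simp only [Finset.mem_insert, Finset.mem_Ioo, Finset.mem_range] at hi ⊢
    omega
  have hlt := h.lt
  rw [Finset.sum_insert (by simp; omega), Finset.sum_insert (by simp)] at h3
  omega

/-- Each insertion pays for itself: a nonzero new sum has not been recorded before and enlarges one
history, while a zero sum ends the process. -/
theorem insert_elem (h : MergeState E w idx pos c l j S H G)
    (hE : IrreducibleSystem E w idx pos c K) {e : ι} (he : e ∈ E) (heS : e ∉ S)
    (hidx : idx e = l ∧ pos l ∨ idx e = j ∧ ¬ pos j)
    (h1 : -(c j : ℤ) ≤ w e + ∑ e ∈ S, w e) (h2 : w e + ∑ e ∈ S, w e ≤ c l) :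
    insert e S = E ∨ ∃ H' G', H'.card + G'.card = H.card + G.card + 1 ∧
      MergeState E w idx pos c l j (insert e S) H' G' := by
  have hlt := h.lt
  have hsuf : ∀ i, l < i → suffixSum w idx i (insert e S) ≤ suffixSum w idx i S := by
    intro i hi
    rw [suffixSum, Finset.sum_insert heS, ← suffixSum]
    refine add_le_of_nonpos_left ?_
    split_ifs with h3
    · exact le_rfl
    · rcases hidx with h4 | h4
      · omega
      · exact (hE.weight_neg e he (h4.1.symm ▸ h4.2)).le
  have hpre : ∀ i, i ≤ j → prefixSum w idx i S ≤ prefixSum w idx i (insert e S) := by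
    intro i hi
    rw [prefixSum, prefixSum, Finset.sum_insert heS]
    refine le_add_of_nonneg_left ?_
    split_ifs with h3
    · rcases hidx with h4 | h4
      · exact (hE.weight_pos e he (h4.1.symm ▸ h4.2)).le
      · omega
    · exact le_rfl
  have hsum : ∑ x ∈ insert e S, w x = w e + ∑ e ∈ S, w e := Finset.sum_insert heS
  have hst : MergeState E w idx pos c l j (insert e S) H G :=
    { lt := hlt
      subset := Finset.insert_subset he h.subset
      mem_idx := by
        intro x hx
        rcases Finset.mem_insert.1 hx with rfl | hx
        · omega
        · exact h.mem_idx x hx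
      rest := fun x hx hl hj hxS => h.rest x hx hl hj fun hxS' =>
        hxS (Finset.mem_insert_of_mem hxS')
      le_sum := hsum ▸ h1
      sum_le := hsum ▸ h2
      prefix_nonneg := fun i hi hij => (h.prefix_nonneg i hi hij).trans (hpre i hij)
      suffix_nonpos := fun i hi hij => (hsuf i hi).trans (h.suffix_nonpos i hi hij)
      posHistory := h.posHistory.mono (Finset.subset_insert e S) hsuf
      negHistory := h.negHistory.mono (Finset.subset_insert e S) hpre }
  rcases lt_trichotomy (∑ x ∈ insert e S, w x) 0 with hv | hv | hv
  · refine Or.inr ⟨H, insert (∑ x ∈ insert e S, w x) G, ?_, ?_⟩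
    · rw [Finset.card_insert_of_notMem, add_assoc]
      intro hmem
      obtain ⟨-, -, S', hS', hs, hi⟩ := h.negHistory _ hmem
      exact hst.not_negHistory hE (hS'.trans_ssubset (Finset.ssubset_insert heS)) hs hv
        fun i hij => ⟨(hi i hij).1.trans (hpre i hij), (hi i hij).2⟩
    · exact { hst with
        negHistory := hst.negHistory.insert (hsum ▸ h1) (by omega) hst.prefix_nonneg' }
  · exact Or.inl (hst.eq_of_sum_eq_zero hE hv (Finset.insert_nonempty e S))
  · refine Or.inr ⟨insert (∑ x ∈ insert e S, w x) H, G, ?_, ?_⟩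
    · rw [Finset.card_insert_of_notMem]
      · omega
      intro hmem
      obtain ⟨-, -, S', hS', hs, hi⟩ := h.posHistory _ hmem
      exact hst.not_posHistory hE (hS'.trans_ssubset (Finset.ssubset_insert heS)) hs hv
        fun i hij => ⟨(hsuf i hij).trans (hi i hij).1, (hi i hij).2⟩
    · exact { hst with
        posHistory := hst.posHistory.insert (by omega) (hsum ▸ h2) hst.suffix_nonpos' }

theorem finish (hE : IrreducibleSystem E w idx pos c K) (hj : j < K) :
    ∀ (n : ℕ) (S : Finset ι) (H G : Finset ℤ), (E \ S).card = n →
      MergeState E w idx pos c l j S H G →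
      S.card ≤ H.card + G.card + ∑ i ∈ Finset.Ioo l j, c i →
      E.card ≤ ∑ i ∈ Finset.range K, c i + 1 ∨ PosItem E w idx pos c l j ∨
        NegItem E w idx pos c l j := by
  intro n
  induction n using Nat.strong_induction_on with
  | _ n ih =>
  intro S H G hn h hcard
  have hlt := h.lt
  have step : ∀ e ∈ E, e ∉ S → (idx e = l ∧ pos l ∨ idx e = j ∧ ¬ pos j) →
      -(c j : ℤ) ≤ w e + ∑ e ∈ S, w e → w e + ∑ e ∈ S, w e ≤ c l →
      E.card ≤ ∑ i ∈ Finset.range K, c i + 1 ∨ PosItem E w idx pos c l j ∨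
        NegItem E w idx pos c l j := by
    intro e he heS hidx h1 h2
    have hci : (insert e S).card = S.card + 1 := Finset.card_insert_of_notMem heS
    rcases h.insert_elem hE he heS hidx h1 h2 with hS | ⟨H', G', hHG, hst⟩
    -- The last element brings the sum to zero and records no value; it accounts for the `+ 1`.
    · have := h.card_add_card_le hj
      left
      rw [← hS]
      omega
    · refine ih _ ?_ _ H' G' rfl hst (by omega)
      rw [← hn]
      refine Finset.card_lt_card ⟨Finset.sdiff_subset_sdiff subset_rfl (Finset.subset_insert e S),
        fun hsub => ?_⟩
      have := hsub (Finset.mem_sdiff.2 ⟨he, heS⟩)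
      simp at this
  -- The sign of the sum selects the next element: from at least `1`, a weight at least `-(c j + 1)`
  -- leads to at least `-c j`; from at most `-1`, a weight at most `c l + 1` leads to at most `c l`.
  rcases lt_or_ge 0 (∑ e ∈ S, w e) with hv | hv
  · by_cases hex : ∃ e ∈ E, e ∉ S ∧ idx e = j ∧ ¬ pos j
    · obtain ⟨e, he, heS, hidx⟩ := hex
      have h1 := (abs_le.1 (hE.weight_le e he)).1
      have h2 := hE.weight_neg e he (hidx.1.symm ▸ hidx.2)
      have h3 := h.sum_le
      rw [hidx.1] at h1
      exact step e he heS (Or.inr hidx) (by omega) (by omega)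
    · right; left
      refine ⟨hlt.le, S, h.subset, H, h.mem_idx, fun e he h1 h2 h3 => ?_, hv.le, h.sum_le,
        h.suffix_nonpos', h.posHistory, ?_⟩
      · exact (h.rest e he h1 h2 h3).resolve_right fun h4 => hex ⟨e, he, h3, h4⟩
      -- Index `j` is exhausted, so the recorded negative values, at most `c j` of them, are charged
      -- to it.
      · have := h.negHistory.card_le
        rw [← Finset.Ioo_insert_right hlt, Finset.sum_insert (by simp)]
        omega
  · by_cases hex : ∃ e ∈ E, e ∉ S ∧ idx e = l ∧ pos l
    · obtain ⟨e, he, heS, hidx⟩ := hex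
      have h3 := h.le_sum
      rcases hv.lt_or_eq with hv' | hv'
      · have h1 := (abs_le.1 (hE.weight_le e he)).2
        have h2 := hE.weight_pos e he (hidx.1.symm ▸ hidx.2)
        rw [hidx.1] at h1
        exact step e he heS (Or.inl hidx) (by omega) (by omega)
      -- From the empty set a weight `c l + 1` would overshoot, so the first element is the one
      -- supplied by `exists_weight_le`.
      · rcases S.eq_empty_or_nonempty with rfl | hne
        · obtain ⟨e', he', hidx', hw⟩ := hE.exists_weight_le e he (hidx.1.symm ▸ hidx.2)
          rw [hidx.1] at hidx' hw
          have h2 := hE.weight_pos e' he' (hidx'.symm ▸ hidx.2)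
          exact step e' he' (Finset.notMem_empty _) (Or.inl ⟨hidx', hidx.2⟩) (by omega) (by omega)
        · exact absurd (h.eq_of_sum_eq_zero hE hv' hne ▸ he) heS
    · right; right
      refine ⟨hlt.le, S, h.subset, G, h.mem_idx, fun e he h1 h2 h3 => ?_, h.le_sum, hv,
        h.prefix_nonneg', h.negHistory, ?_⟩
      · exact (h.rest e he h1 h2 h3).resolve_left fun h4 => hex ⟨e, he, h3, h4⟩
      · have := h.posHistory.card_le
        rw [← Finset.Ioo_insert_left hlt, Finset.sum_insert (by simp)]
        omega

end MergeState

/-- The union of the two used sets is a merge state: the left one has nonnegative prefix sums and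
the right one nonpositive suffix sums, so neither spoils the other's history. The greedy process
then continues from there. -/
theorem PosItem.merge {l k j : ℕ} (hE : IrreducibleSystem E w idx pos c K) (hj : j < K)
    (hP : PosItem E w idx pos c l k) (hN : NegItem E w idx pos c (k + 1) j) :
    E.card ≤ ∑ i ∈ Finset.range K, c i + 1 ∨ PosItem E w idx pos c l j ∨
      NegItem E w idx pos c l j := by
  obtain ⟨hlk, A, hA, H, hAi, hAr, hA0, hAc, hAs, hAH, hAcard⟩ := hP
  obtain ⟨hkj, B, hB, G, hBi, hBr, hBc, hB0, hBp, hBG, hBcard⟩ := hN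
  have hdis : Disjoint A B := Finset.disjoint_left.2 fun e he he' => by
    have := hAi e he
    have := hBi e he'
    omega
  have hsuf : ∀ i, suffixSum w idx i (A ∪ B) = suffixSum w idx i A + suffixSum w idx i B :=
    fun i => Finset.sum_union hdis
  have hpre : ∀ i, prefixSum w idx i (A ∪ B) = prefixSum w idx i A + prefixSum w idx i B :=
    fun i => Finset.sum_union hdis
  have hsum : ∑ e ∈ A ∪ B, w e = ∑ e ∈ A, w e + ∑ e ∈ B, w e := Finset.sum_union hdis
  have hAp : ∀ i, l < i → 0 ≤ prefixSum w idx i A := fun i hi => by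
    have := prefixSum_add_suffixSum (w := w) (idx := idx) i A
    have := hAs i hi
    linarith
  have hAp' : ∀ i, 0 ≤ prefixSum w idx i A := fun i => by
    rcases le_or_gt i l with hi | hi
    · exact (prefixSum_eq_zero fun e he => hi.trans (hAi e he).1).ge
    · exact hAp i hi
  have hBs : ∀ i, suffixSum w idx i B ≤ 0 := fun i => by
    rcases le_or_gt i j with hi | hi
    · have := prefixSum_add_suffixSum (w := w) (idx := idx) i B
      have := hBp i hi
      linarith
    · exact (suffixSum_eq_zero fun e he => (hBi e he).2.trans_lt hi).le
  refine MergeState.finish hE hj _ (A ∪ B) H G rfl ⟨by omega, Finset.union_subset hA hB, ?_, ?_,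
    by omega, by omega, ?_, ?_, ?_, ?_⟩ ?_
  · intro e he
    rcases Finset.mem_union.1 he with he | he
    · have := hAi e he
      omega
    · have := hBi e he
      omega
  · intro e he h1 h2 h3
    rw [Finset.mem_union, not_or] at h3
    rcases le_or_gt (idx e) k with h4 | h4
    · exact Or.inl (hAr e he h1 h4 h3.1)
    · exact Or.inr (hBr e he h4 h2 h3.2)
  · intro i hi hij
    rw [hpre]
    exact add_nonneg (hAp i hi) (hBp i hij)
  · intro i hi hij
    rw [hsuf]
    exact add_nonpos (hAs i hi) (hBs i)
  · refine hAH.mono Finset.subset_union_left fun i hi => ?_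
    rw [hsuf]
    linarith [hBs i]
  · refine hBG.mono Finset.subset_union_right fun i hi => ?_
    rw [hpre]
    linarith [hAp' i]
  · have h1 : Finset.Ioo l j = Finset.Ioc l k ∪ Finset.Ico (k + 1) j := by
      ext i
      simp only [Finset.mem_Ioo, Finset.mem_union, Finset.mem_Ioc, Finset.mem_Ico]
      omega
    have h2 : Disjoint (Finset.Ioc l k) (Finset.Ico (k + 1) j) :=
      Finset.disjoint_left.2 fun i hi hi' => by
        simp only [Finset.mem_Ioc, Finset.mem_Ico] at hi hi'
        omega
    rw [h1, Finset.sum_union h2, Finset.card_union_of_disjoint hdis]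
    omega

/-! ### The stack of positive items and the cardinality bound -/

/-- The indices less than `m` can be divided into positive items. -/
inductive ItemStack (E : Finset ι) (w : ι → ℤ) (idx : ι → ℕ) (pos : ℕ → Prop) (c : ℕ → ℕ) :
    ℕ → Prop
  | zero : ItemStack E w idx pos c 0
  | push {l j : ℕ} : ItemStack E w idx pos c l → PosItem E w idx pos c l j →
      ItemStack E w idx pos c (j + 1)

namespace IrreducibleSystem

/-- A vanishing prefix sum cuts `E` into two balanced parts, one of which must be empty. -/
theorem filter_lt_trivial (hE : IrreducibleSystem E w idx pos c K) {m : ℕ}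
    (hm : prefixSum w idx m E ≤ 0) :
    (∀ e ∈ E, m ≤ idx e) ∨ ∀ e ∈ E, idx e < m := by
  have hm0 : prefixSum w idx m E = 0 := le_antisymm hm (hE.balanced.2 m)
  have hsub : E.filter (fun e => idx e < m) ⊆ E := Finset.filter_subset _ _
  have hsum : ∑ e ∈ E.filter (fun e => idx e < m), w e = 0 := by
    rw [Finset.sum_filter]
    exact hm0
  have hpre : ∀ i, prefixSum w idx i (E.filter fun e => idx e < m) =
      prefixSum w idx (min i m) E := by
    intro i
    rw [prefixSum, prefixSum, Finset.sum_filter]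
    refine Finset.sum_congr rfl fun e _ => ?_
    simp only [lt_min_iff]
    split_ifs <;> tauto
  rcases hE.irreducible _ hsub ⟨hsum, fun i => (hpre i).symm ▸ hE.balanced.2 _⟩
    ⟨by rw [weightSum_sdiff hsub, hsum, hE.balanced.1, sub_zero], fun i => by
      rw [prefixSum_sdiff _ hsub, hpre]
      rcases le_total i m with h | h
      · rw [min_eq_left h, sub_self]
      · rw [min_eq_right h, hm0, sub_zero]
        exact hE.balanced.2 i⟩ with h | h
  · left
    intro e he
    by_contra hlt
    exact Finset.notMem_empty e (h ▸ Finset.mem_filter.2 ⟨he, not_le.1 hlt⟩)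
  · right
    intro e he
    rw [← h] at he
    exact (Finset.mem_filter.1 he).2

theorem posItem_singleton {m : ℕ} (hm : pos m) : PosItem E w idx pos c m m := by
  refine ⟨le_rfl, ∅, Finset.empty_subset _, ∅, by simp, fun e _ h1 h2 _ => ⟨by omega, hm⟩,
    by simp, by simp, fun i _ => by simp [suffixSum], fun h hh => absurd hh (by simp), by simp⟩

theorem negItem_singleton {m : ℕ} (hm : ¬ pos m) : NegItem E w idx pos c m m := by
  refine ⟨le_rfl, ∅, Finset.empty_subset _, ∅, by simp, fun e _ h1 h2 _ => ⟨by omega, hm⟩,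
    by simp, by simp, fun i _ => by simp [prefixSum], fun h hh => absurd hh (by simp), by simp⟩

/-- The negative item is merged with the top of the stack for as long as the result is negative. If
it swallows the whole stack, the prefix sum through `j` is at most zero, and `filter_lt_trivial`
decides. -/
theorem absorb (hE : IrreducibleSystem E w idx pos c K) {l : ℕ}
    (hl : ItemStack E w idx pos c l) : ∀ j, j < K → NegItem E w idx pos c l j →
    E.card ≤ ∑ i ∈ Finset.range K, c i + 1 ∨ ItemStack E w idx pos c (j + 1) := by
  induction hl with
  | zero =>
    intro j hj ⟨_, S, hS, H, _, hr, _, hS0, _, hH, hcard⟩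
    have hneg : ∀ e ∈ E \ S, idx e ≤ j → w e < 0 := fun e he hej => by
      obtain ⟨heE, heS⟩ := Finset.mem_sdiff.1 he
      have := hr e heE (Nat.zero_le _) hej heS
      exact hE.weight_neg e heE (this.1.symm ▸ this.2)
    have hpre : prefixSum w idx (j + 1) E ≤ 0 := by
      have h1 : prefixSum w idx (j + 1) S = ∑ e ∈ S, w e :=
        Finset.sum_congr rfl fun e he => if_pos (by have := ‹∀ e ∈ S, _› e he; omega)
      have h2 : prefixSum w idx (j + 1) (E \ S) ≤ 0 := by
        refine Finset.sum_nonpos fun e he => ?_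
        split_ifs with h
        · exact (hneg e he (by omega)).le
        · exact le_rfl
      rw [prefixSum_sdiff _ hS] at h2
      omega
    rcases hE.filter_lt_trivial hpre with h | h
    -- No element has index at most `j`, so the empty set serves as a positive item on `[0, j]`
    -- vacuously.
    · refine Or.inr (.push .zero ⟨Nat.zero_le _, ∅, Finset.empty_subset _, ∅, by simp,
        fun e he _ hej _ => ?_, by simp, by simp, fun i _ => by simp [suffixSum],
        fun h hh => absurd hh (by simp), by simp⟩)
      have := h e he
      omega
    · have hES : E \ S = ∅ := by
        by_contra hne
        have hlt : ∑ e ∈ E \ S, w e < 0 :=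
          Finset.sum_neg (fun e he => hneg e he (by
            have := h e (Finset.sdiff_subset he)
            omega)) (Finset.nonempty_iff_ne_empty.2 hne)
        have h1 := Finset.sum_sdiff (f := w) hS
        have h2 := hE.balanced.1
        omega
      left
      have h1 := Finset.card_le_card (Finset.sdiff_eq_empty_iff_subset.1 hES)
      have h2 := hH.card_le
      have h3 : ∑ i ∈ insert j (Finset.Ico 0 j), c i ≤ ∑ i ∈ Finset.range K, c i :=
        Finset.sum_le_sum_of_subset fun i hi => by
          simp only [Finset.mem_insert, Finset.mem_Ico, Finset.mem_range] at hi ⊢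
          omega
      rw [Finset.sum_insert (by simp)] at h3
      omega
  | @push l k hl hP ih =>
    intro j hj hN
    rcases hP.merge hE hj hN with h | h | h
    · exact Or.inl h
    · exact Or.inr (hl.push h)
    · exact ih j hj h

/-- The top item has nonnegative sum and only positive elements are left beside it, so the prefix
sum before it vanishes. Either this item is all of `E`, or it contains nothing and the stack below
suffices. -/
theorem card_le_of_itemStack (hE : IrreducibleSystem E w idx pos c K) {m : ℕ}
    (hm : ItemStack E w idx pos c m) (hmK : m ≤ K) (hidx : ∀ e ∈ E, idx e < m) :
    E.card ≤ ∑ i ∈ Finset.range K, c i + 1 := by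
  induction hm with
  | zero =>
    have : E = ∅ := Finset.eq_empty_of_forall_notMem fun e he => absurd (hidx e he) (by omega)
    simp [this]
  | @push l j hl hP ih =>
    obtain ⟨hlj, S, hS, H, hi, hr, hS0, _, _, hH, hcard⟩ := hP
    have hpos : ∀ e ∈ E \ S, l ≤ idx e → 0 < w e := fun e he hel => by
      obtain ⟨heE, heS⟩ := Finset.mem_sdiff.1 he
      have := hr e heE hel (Nat.le_of_lt_succ (hidx e heE)) heS
      exact hE.weight_pos e heE (this.1.symm ▸ this.2)
    have hpre : prefixSum w idx l E ≤ 0 := by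
      have h1 : suffixSum w idx l S = ∑ e ∈ S, w e :=
        Finset.sum_congr rfl fun e he => if_neg (not_lt.2 (hi e he).1)
      have h2 : 0 ≤ suffixSum w idx l (E \ S) := by
        refine Finset.sum_nonneg fun e he => ?_
        split_ifs with h
        · exact le_rfl
        · exact (hpos e he (by omega)).le
      rw [suffixSum_sdiff _ hS] at h2
      have h3 := prefixSum_add_suffixSum (w := w) (idx := idx) l E
      have h4 := hE.balanced.1
      omega
    rcases hE.filter_lt_trivial hpre with h | h
    · have hES : E \ S = ∅ := by
        by_contra hne
        have hlt : 0 < ∑ e ∈ E \ S, w e :=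
          Finset.sum_pos (fun e he => hpos e he (h e (Finset.sdiff_subset he)))
            (Finset.nonempty_iff_ne_empty.2 hne)
        have h1 := Finset.sum_sdiff (f := w) hS
        have h2 := hE.balanced.1
        omega
      have h1 := Finset.card_le_card (Finset.sdiff_eq_empty_iff_subset.1 hES)
      have h2 := hH.card_le
      have h3 : ∑ i ∈ insert l (Finset.Ioc l j), c i ≤ ∑ i ∈ Finset.range K, c i :=
        Finset.sum_le_sum_of_subset fun i hi => by
          simp only [Finset.mem_insert, Finset.mem_Ioc, Finset.mem_range] at hi ⊢
          omega
      rw [Finset.sum_insert (by simp)] at h3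
      omega
    · exact ih (by omega) h

/-- The number of elements of an irreducible signed system is bounded in terms of the bounds on
the weights. -/
theorem card_le (hE : IrreducibleSystem E w idx pos c K) :
    E.card ≤ ∑ i ∈ Finset.range K, c i + 1 := by
  by_contra hcon
  have hst : ∀ m, m ≤ K → ItemStack E w idx pos c m := by
    intro m
    induction m with
    | zero => exact fun _ => .zero
    | succ m ih =>
      intro hm
      by_cases hpm : pos m
      · exact (ih (by omega)).push (posItem_singleton hpm)
      · exact (hE.absorb (ih (by omega)) m hm (negItem_singleton hpm)).resolve_left hcon
  exact hcon (hE.card_le_of_itemStack (hst K le_rfl) le_rfl hE.idx_lt)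

end IrreducibleSystem

/-! ### Reversal symmetry and the case of equality -/

theorem prefixSum_reverse (hidx : ∀ e ∈ E, idx e < K) {T : Finset ι} (hT : T ⊆ E)
    (hsum : ∑ e ∈ T, w e = 0) (i : ℕ) :
    prefixSum (fun e => -w e) (fun e => K - 1 - idx e) i T = prefixSum w idx (K - i) T := by
  have h1 := prefixSum_add_suffixSum (w := w) (idx := idx) (K - i) T
  have h2 : prefixSum (fun e => -w e) (fun e => K - 1 - idx e) i T =
      -suffixSum w idx (K - i) T := by
    rw [prefixSum, suffixSum, ← Finset.sum_neg_distrib]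
    refine Finset.sum_congr rfl fun e he => ?_
    have := hidx e (hT he)
    split_ifs <;> omega
  omega

theorem isBalanced_reverse_iff (hidx : ∀ e ∈ E, idx e < K) {T : Finset ι} (hT : T ⊆ E) :
    IsBalanced (fun e => -w e) (fun e => K - 1 - idx e) T ↔ IsBalanced w idx T := by
  rw [IsBalanced, IsBalanced, Finset.sum_neg_distrib, neg_eq_zero]
  refine and_congr_right fun hsum => ?_
  simp only [prefixSum_reverse hidx hT hsum]
  refine ⟨fun h i => ?_, fun h i => h _⟩
  rcases le_total i K with hi | hi
  · have := h (K - i)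
    rwa [Nat.sub_sub_self hi] at this
  · have h1 := prefixSum_add_suffixSum (w := w) (idx := idx) i T
    rw [suffixSum_eq_zero fun e he => (hidx e (hT he)).trans_le hi, hsum] at h1
    omega

namespace IrreducibleSystem

/-- Former negative elements become positive and now need `exists_weight_le`; the sharper bound
`hle` provides it. -/
theorem reverse (hE : IrreducibleSystem E w idx pos c K)
    (hle : ∀ e ∈ E, |w e| ≤ c (idx e)) :
    IrreducibleSystem E (fun e => -w e) (fun e => K - 1 - idx e)
      (fun i => ¬ pos (K - 1 - i)) (fun i => c (K - 1 - i)) K := by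
  have hrev : ∀ e ∈ E, K - 1 - (K - 1 - idx e) = idx e := fun e he => by
    have := hE.idx_lt e he
    omega
  exact
    { idx_lt := fun e he => by
        have := hE.idx_lt e he
        omega
      balanced := (isBalanced_reverse_iff hE.idx_lt subset_rfl).2 hE.balanced
      irreducible := fun T hT h1 h2 => hE.irreducible T hT
        ((isBalanced_reverse_iff hE.idx_lt hT).1 h1)
        ((isBalanced_reverse_iff hE.idx_lt Finset.sdiff_subset).1 h2)
      weight_pos := fun e he h => by
        rw [hrev e he] at h
        exact neg_pos.2 (hE.weight_neg e he h)
      weight_neg := fun e he h => by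
        rw [hrev e he, not_not] at h
        exact neg_neg_iff_pos.2 (hE.weight_pos e he h)
      weight_le := fun e he => by
        rw [hrev e he, abs_neg]
        exact hE.weight_le e he
      exists_weight_le := fun e he h => ⟨e, he, rfl, by
        rw [hrev e he]
        exact (neg_le_abs _).trans (hle e he)⟩ }

/-- If all weights are bounded by `N` then the number of elements is at most the sum of the
bounds, and equality forces the negative elements to have a single index and the weights of
positive elements to be maximal. -/
theorem card_le_sum {N : ℕ → ℕ} (hE : IrreducibleSystem E w idx pos N K)
    (hle : ∀ e ∈ E, |w e| ≤ N (idx e)) {a : ι} (ha : a ∈ E) (hneg : w a < 0) :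
    E.card ≤ ∑ i ∈ Finset.range K, N i ∧ (E.card = ∑ i ∈ Finset.range K, N i →
      (∀ e ∈ E, w e < 0 → idx e = idx a) ∧ ∀ e ∈ E, 0 < w e → w e = N (idx e)) := by
  classical
  have hN : ∀ e ∈ E, 1 ≤ N (idx e) := fun e he => by
    have h1 := hle e he
    have h2 : 0 < |w e| := by
      by_cases h : pos (idx e)
      · exact abs_pos.2 (hE.weight_pos e he h).ne'
      · exact abs_pos.2 (hE.weight_neg e he h).ne
    omega
  have hposiff : ∀ e ∈ E, pos (idx e) ↔ 0 < w e := fun e he =>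
    ⟨hE.weight_pos e he, fun h => by
      by_contra h'
      exact (hE.weight_neg e he h').not_gt h⟩
  -- The smallest bound that `exists_weight_le` and `weight_le` permit. Every index carrying a
  -- negative element is lowered.
  set c : ℕ → ℕ := fun i => if ∃ e ∈ E, idx e = i ∧ w e < N i then N i - 1 else N i with hc
  have hcN : ∀ i, c i ≤ N i := fun i => by
    simp only [hc]
    split_ifs <;> omega
  have hcN' : ∀ i, N i ≤ c i + 1 := fun i => by
    simp only [hc]
    split_ifs <;> omega
  have hsmall : ∀ e ∈ E, w e < N (idx e) → c (idx e) < N (idx e) := fun e he h => by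
    have h1 : c (idx e) = N (idx e) - 1 := if_pos ⟨e, he, rfl, h⟩
    have := hN e he
    omega
  have hEc : IrreducibleSystem E w idx pos c K :=
    { hE with
      weight_le := fun e he => (hle e he).trans (by exact_mod_cast hcN' _)
      exists_weight_le := fun e he _ => by
        by_cases h : ∃ e' ∈ E, idx e' = idx e ∧ w e' < N (idx e)
        · have h1 : c (idx e) = N (idx e) - 1 := if_pos h
          have := hN e he
          obtain ⟨e', he', h2, h3⟩ := h
          exact ⟨e', he', h2, by omega⟩
        · have h1 : c (idx e) = N (idx e) := if_neg h
          exact ⟨e, he, rfl, by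
            rw [h1]
            exact (le_abs_self _).trans (hle e he)⟩ }
  have hcard := hEc.card_le
  have hlt : ∑ i ∈ Finset.range K, c i < ∑ i ∈ Finset.range K, N i :=
    Finset.sum_lt_sum (fun i _ => hcN i)
      ⟨idx a, Finset.mem_range.2 (hE.idx_lt a ha), hsmall a ha (by omega)⟩
  refine ⟨by omega, fun heq => ?_⟩
  -- A second lowered index would save two, one more than the `+ 1` in `hcard` costs.
  have huniq : ∀ e ∈ E, w e < N (idx e) → idx e = idx a := by
    intro e he h
    by_contra hne
    have h1 : ∑ i ∈ insert (idx e) {idx a}, (N i - c i) ≤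
        ∑ i ∈ Finset.range K, (N i - c i) :=
      Finset.sum_le_sum_of_subset fun i hi => by
        rcases Finset.mem_insert.1 hi with rfl | hi
        · exact Finset.mem_range.2 (hE.idx_lt e he)
        · rw [Finset.mem_singleton.1 hi]
          exact Finset.mem_range.2 (hE.idx_lt a ha)
    rw [Finset.sum_insert (by simpa using hne), Finset.sum_singleton] at h1
    have h2 : ∑ i ∈ Finset.range K, (N i - c i) + ∑ i ∈ Finset.range K, c i =
        ∑ i ∈ Finset.range K, N i := by
      rw [← Finset.sum_add_distrib]
      exact Finset.sum_congr rfl fun i _ => Nat.sub_add_cancel (hcN i)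
    have h3 := hsmall e he h
    have h4 := hsmall a ha (by omega)
    omega
  refine ⟨fun e he h => huniq e he (by omega), fun e he h => ?_⟩
  by_contra hne
  have h1 := (le_abs_self _).trans (hle e he)
  have h2 := huniq e he (by omega)
  have h3 := (hposiff e he).2 h
  rw [h2] at h3
  exact ((hposiff a ha).1 h3).not_gt hneg

/-- The symmetric version of `IrreducibleSystem.card_le_sum`. -/
theorem eq_of_card_eq_sum {N : ℕ → ℕ} (hE : IrreducibleSystem E w idx pos N K)
    (hle : ∀ e ∈ E, |w e| ≤ N (idx e)) {a : ι} (ha : a ∈ E) (hpos : 0 < w a)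
    (hcard : E.card = ∑ i ∈ Finset.range K, N i) :
    (∀ e ∈ E, 0 < w e → idx e = idx a) ∧ ∀ e ∈ E, w e < 0 → -w e = N (idx e) := by
  have hrev : ∀ e ∈ E, K - 1 - (K - 1 - idx e) = idx e := fun e he => by
    have := hE.idx_lt e he
    omega
  obtain ⟨h1, h2⟩ := ((hE.reverse hle).card_le_sum (fun e he => by
    rw [hrev e he, abs_neg]
    exact hle e he) ha (neg_lt_zero.2 hpos)).2 (by rw [Finset.sum_range_reflect, hcard])
  refine ⟨fun e he h => ?_, fun e he h => ?_⟩
  · have := h1 e he (neg_lt_zero.2 h)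
    rw [← hrev e he, this, hrev a ha]
  · rw [h2 e he (neg_pos.2 h), hrev e he]

end IrreducibleSystem

end SignedSystems

/-! ### Partitions as sets of columns -/

theorem mem_kostkaSemigroup_iff {r : ℕ} {p : (Fin r → ℤ) × (Fin r → ℤ)} :
    p ∈ kostkaSemigroup r ↔ Antitone p.1 ∧ (∀ i, 0 ≤ p.1 i) ∧ Antitone p.2 ∧ (∀ i, 0 ≤ p.2 i) ∧
      (∀ t : Fin r, ∑ i ∈ Finset.Iic t, p.2 i ≤ ∑ i ∈ Finset.Iic t, p.1 i) ∧
      ∑ i, p.1 i = ∑ i, p.2 i := by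
  change (_ ∧ _) ↔ _
  simp only [Antitone]
  norm_cast

/-- The height of the `k`-th column of a partition, counted from zero. -/
def columnHeight {r : ℕ} (v : Fin r → ℤ) (k : ℕ) : ℕ :=
  (Finset.univ.filter fun x => (k : ℤ) < v x).card

theorem columnHeight_le {r : ℕ} (v : Fin r → ℤ) (k : ℕ) : columnHeight v k ≤ r :=
  (Finset.card_le_univ _).trans (Fintype.card_fin r).le

theorem lt_columnHeight_iff {r : ℕ} {v : Fin r → ℤ} (hv : Antitone v) (k : ℕ) (x : Fin r) :
    (x : ℕ) < columnHeight v k ↔ (k : ℤ) < v x := by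
  constructor
  · intro h
    by_contra hk
    have hsub : (Finset.univ.filter fun x => (k : ℤ) < v x) ⊆ Finset.Iio x := fun y hy => by
      rw [Finset.mem_Iio]
      by_contra hxy
      exact hk ((Finset.mem_filter.1 hy).2.trans_le (hv (not_lt.1 hxy)))
    have := Finset.card_le_card hsub
    rw [Fin.card_Iio] at this
    exact absurd h (not_lt.2 this)
  · intro h
    have hsub : Finset.Iic x ⊆ (Finset.univ.filter fun x => (k : ℤ) < v x) := fun y hy =>
      Finset.mem_filter.2 ⟨Finset.mem_univ _, h.trans_le (hv (Finset.mem_Iic.1 hy))⟩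
    have := Finset.card_le_card hsub
    rw [Fin.card_Iic] at this
    exact this

/-- The partition whose columns have heights `a k` for `k ∈ T`. -/
def ofColumns {ι : Type*} (r : ℕ) (a : ι → ℕ) (T : Finset ι) : Fin r → ℤ :=
  fun x => (T.filter fun k => (x : ℕ) < a k).card

theorem ofColumns_columnHeight {r n : ℕ} {v : Fin r → ℤ} (hv : Antitone v) (h0 : ∀ x, 0 ≤ v x)
    (hn : ∀ x, v x ≤ n) : ofColumns r (columnHeight v) (Finset.range n) = v := by
  funext x
  have : (Finset.range n).filter (fun k => (x : ℕ) < columnHeight v k) =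
      Finset.range (v x).toNat := by
    ext k
    have := h0 x
    have := hn x
    simp only [Finset.mem_filter, Finset.mem_range, lt_columnHeight_iff hv]
    omega
  rw [ofColumns, this, Finset.card_range, Int.toNat_of_nonneg (h0 x)]

theorem ofColumns_add_sdiff {ι : Type*} [DecidableEq ι] (r : ℕ) (a : ι → ℕ) {T E : Finset ι}
    (hT : T ⊆ E) : ofColumns r a T + ofColumns r a (E \ T) = ofColumns r a E := by
  funext x
  simp only [ofColumns, Pi.add_apply, Finset.card_filter]
  rw [← Finset.sum_sdiff hT]
  push_cast
  ring

theorem sum_Iic_ofColumns {ι : Type*} {r : ℕ} (a : ι → ℕ) (T : Finset ι) (t : Fin r) :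
    ∑ i ∈ Finset.Iic t, ofColumns r a T i = ∑ k ∈ T, ((min (a k) (t + 1) : ℕ) : ℤ) := by
  simp only [ofColumns, Finset.card_filter]
  push_cast
  rw [Finset.sum_comm]
  refine Finset.sum_congr rfl fun k _ => ?_
  have h1 : ∑ i ∈ Finset.Iic t, (if (i : ℕ) < a k then (1 : ℤ) else 0) =
      ∑ i ∈ (Finset.Iic t).map Fin.valEmbedding, if i < a k then (1 : ℤ) else 0 := by
    rw [Finset.sum_map]
    rfl
  have h2 : (Finset.Iic (t : ℕ)).filter (fun i => i < a k) = Finset.range (min (a k) (t + 1)) := by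
    ext i
    simp only [Finset.mem_filter, Finset.mem_Iic, Finset.mem_range]
    omega
  rw [h1, Fin.map_valEmbedding_Iic, ← Finset.sum_filter, h2]
  simp

theorem sum_ofColumns {ι : Type*} {r : ℕ} {a : ι → ℕ} {T : Finset ι} (ha : ∀ k ∈ T, a k ≤ r) :
    ∑ i, ofColumns r a T i = ∑ k ∈ T, (a k : ℤ) := by
  cases r with
  | zero =>
    rw [Finset.univ_eq_empty, Finset.sum_empty]
    symm
    exact Finset.sum_eq_zero fun k hk => by simpa using ha k hk
  | succ r =>
    have h := sum_Iic_ofColumns a T (Fin.last r)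
    rw [← Fin.top_eq_last, Finset.Iic_top] at h
    rw [h]
    refine Finset.sum_congr rfl fun k hk => ?_
    rw [Fin.top_eq_last, Fin.val_last, min_eq_left (ha k hk)]

theorem antitone_ofColumns {ι : Type*} (r : ℕ) (a : ι → ℕ) (T : Finset ι) :
    Antitone (ofColumns r a T) := fun x y hxy => by
  simp only [ofColumns, Nat.cast_le]
  exact Finset.card_le_card (Finset.monotone_filter_right _ fun k _ h =>
    lt_of_le_of_lt (by exact_mod_cast hxy) h)

/-- The sum of the differences of the two partitions with columns `a k`, `b k` for `k ∈ T` over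
the first `x` rows. -/
def rowExcess {ι : Type*} (a b : ι → ℕ) (T : Finset ι) (x : ℕ) : ℤ :=
  ∑ k ∈ T, ((min (a k) x : ℕ) - (min (b k) x : ℕ) : ℤ)

theorem ofColumns_mem {ι : Type*} {r : ℕ} {a b : ι → ℕ} {T : Finset ι} (ha : ∀ k ∈ T, a k ≤ r)
    (hb : ∀ k ∈ T, b k ≤ r) (hT : ∀ x, x ≤ r → 0 ≤ rowExcess a b T x)
    (hsum : ∑ k ∈ T, ((a k : ℤ) - b k) = 0) :
    (ofColumns r a T, ofColumns r b T) ∈ kostkaSemigroup r := by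
  rw [Finset.sum_sub_distrib] at hsum
  refine mem_kostkaSemigroup_iff.2 ⟨antitone_ofColumns r a T, fun _ => Int.natCast_nonneg _,
    antitone_ofColumns r b T, fun _ => Int.natCast_nonneg _, fun t => ?_, ?_⟩
  · have := hT (t + 1) t.2
    rw [rowExcess, Finset.sum_sub_distrib] at this
    rw [sum_Iic_ofColumns, sum_Iic_ofColumns]
    exact sub_nonneg.1 this
  · rw [sum_ofColumns ha, sum_ofColumns hb]
    linarith

/-! ### Runs of constant sign -/

/-- The first position of the run of equal values of `σ` containing `x`. -/
def runStart {α : Type*} [DecidableEq α] (σ : ℕ → α) : ℕ → ℕ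
  | 0 => 0
  | x + 1 => if σ (x + 1) = σ x then runStart σ x else x + 1

section Runs

variable {α : Type*} [DecidableEq α] (σ : ℕ → α)

theorem runStart_le (x : ℕ) : runStart σ x ≤ x := by
  induction x with
  | zero => exact le_rfl
  | succ x ih =>
    rw [runStart]
    split_ifs <;> omega

theorem runStart_mono : Monotone (runStart σ) := by
  refine monotone_nat_of_le_succ fun x => ?_
  have := runStart_le σ x
  rw [runStart]
  split_ifs <;> omega

theorem apply_runStart (x : ℕ) : σ (runStart σ x) = σ x := by
  induction x with
  | zero => rfl
  | succ x ih =>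
    rw [runStart]
    split_ifs with h
    · rw [ih, h]
    · rfl

theorem runStart_runStart (x : ℕ) : runStart σ (runStart σ x) = runStart σ x := by
  induction x with
  | zero => rfl
  | succ x ih =>
    by_cases h : σ (x + 1) = σ x
    · rw [show runStart σ (x + 1) = runStart σ x from if_pos h, ih]
    · have h1 : runStart σ (x + 1) = x + 1 := if_neg h
      rw [h1, h1]

theorem runStart_eq_of_const {m x : ℕ} (hmx : m ≤ x) (h : ∀ y, m ≤ y → y ≤ x → σ y = σ m) :
    runStart σ x = runStart σ m := by
  induction x, hmx using Nat.le_induction with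
  | base => rfl
  | succ x hx ih =>
    rw [← ih fun y h1 h2 => h y h1 (by omega)]
    exact if_pos ((h _ (by omega) le_rfl).trans (h _ hx (by omega)).symm)

end Runs

/-! ### Column pairs as a signed system -/

/-- Pairs of column heights `a k`, `b k` of two partitions with at most `r` rows, such that the
sign `σ` of the difference of the partitions is constant between `a k` and `b k`. -/
structure ColumnPairs {ι : Type*} (E : Finset ι) (a b : ι → ℕ) (σ : ℕ → SignType) (r : ℕ) :
    Prop where
  le_left : ∀ k ∈ E, a k ≤ r
  le_right : ∀ k ∈ E, b k ≤ r
  ne : ∀ k ∈ E, a k ≠ b k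
  sign_pos : ∀ k ∈ E, ∀ x, b k ≤ x → x < a k → σ x = 1
  sign_neg : ∀ k ∈ E, ∀ x, a k ≤ x → x < b k → σ x = -1

/-- The weight of a column pair. -/
def columnWeight {ι : Type*} (a b : ι → ℕ) (k : ι) : ℤ := a k - b k

/-- The first position of the run of equal signs containing a column pair. -/
def columnIndex {ι : Type*} (a b : ι → ℕ) (σ : ℕ → SignType) (k : ι) : ℕ :=
  runStart σ (min (a k) (b k))

/-- The positions in the run of equal nonzero signs that starts at `i`. -/
def signRun (σ : ℕ → SignType) (r i : ℕ) : Finset ℕ :=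
  (Finset.range r).filter fun x => σ x ≠ 0 ∧ runStart σ x = i

theorem sum_card_signRun (σ : ℕ → SignType) (r : ℕ) :
    ∑ i ∈ Finset.range r, (signRun σ r i).card =
      ((Finset.range r).filter fun x => σ x ≠ 0).card := by
  rw [Finset.card_eq_sum_card_fiberwise (f := runStart σ) (t := Finset.range r)]
  · refine Finset.sum_congr rfl fun i _ => ?_
    rw [Finset.filter_filter, signRun]
  · intro x hx
    have := (Finset.mem_filter.1 hx).1
    simp only [Finset.coe_range, Set.mem_Iio, Finset.mem_range] at this ⊢
    exact (runStart_le σ x).trans_lt this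

namespace ColumnPairs

variable {ι : Type*} {E : Finset ι} {a b : ι → ℕ} {σ : ℕ → SignType} {r : ℕ}

theorem sign_const (h : ColumnPairs E a b σ r) {k : ι} (hk : k ∈ E) {x : ℕ}
    (h1 : min (a k) (b k) ≤ x) (h2 : x < max (a k) (b k)) :
    σ x = if b k < a k then 1 else -1 := by
  split_ifs with hab
  · exact h.sign_pos k hk x (by omega) (by omega)
  · exact h.sign_neg k hk x (by omega) (by omega)

theorem min_lt_max (h : ColumnPairs E a b σ r) {k : ι} (hk : k ∈ E) :
    min (a k) (b k) < max (a k) (b k) := by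
  have := h.ne k hk
  omega

theorem runStart_eq (h : ColumnPairs E a b σ r) {k : ι} (hk : k ∈ E) {x : ℕ}
    (h1 : min (a k) (b k) ≤ x) (h2 : x < max (a k) (b k)) :
    runStart σ x = columnIndex a b σ k := by
  refine runStart_eq_of_const σ h1 fun y hy1 hy2 => ?_
  rw [h.sign_const hk hy1 (by omega), h.sign_const hk le_rfl (h.min_lt_max hk)]

theorem sign_columnIndex (h : ColumnPairs E a b σ r) {k : ι} (hk : k ∈ E) :
    σ (columnIndex a b σ k) = if b k < a k then 1 else -1 := by
  rw [columnIndex, apply_runStart σ, h.sign_const hk le_rfl (h.min_lt_max hk)]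

theorem columnIndex_lt (h : ColumnPairs E a b σ r) {k : ι} (hk : k ∈ E) :
    columnIndex a b σ k < r := by
  have h1 := runStart_le σ (min (a k) (b k))
  have h2 := h.min_lt_max hk
  have h3 := h.le_left k hk
  have h4 := h.le_right k hk
  rw [columnIndex]
  omega

theorem Ico_subset_signRun (h : ColumnPairs E a b σ r) {k : ι} (hk : k ∈ E) :
    Finset.Ico (min (a k) (b k)) (max (a k) (b k)) ⊆ signRun σ r (columnIndex a b σ k) := by
  intro x hx
  rw [Finset.mem_Ico] at hx
  have h3 := h.le_left k hk
  have h4 := h.le_right k hk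
  refine Finset.mem_filter.2 ⟨Finset.mem_range.2 (by omega), ?_, h.runStart_eq hk hx.1 hx.2⟩
  rw [h.sign_const hk hx.1 hx.2]
  split_ifs <;> decide

theorem card_Ico (k : ι) :
    ((Finset.Ico (min (a k) (b k)) (max (a k) (b k))).card : ℤ) = |columnWeight a b k| := by
  rw [Nat.card_Ico, columnWeight]
  rcases le_total (a k) (b k) with hab | hab
  · rw [abs_of_nonpos (by omega)]
    omega
  · rw [abs_of_nonneg (by omega)]
    omega

theorem abs_columnWeight_le (h : ColumnPairs E a b σ r) {k : ι} (hk : k ∈ E) :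
    |columnWeight a b k| ≤ (signRun σ r (columnIndex a b σ k)).card := by
  rw [← card_Ico]
  exact_mod_cast Finset.card_le_card (h.Ico_subset_signRun hk)

/-- At row `x`, pairs of earlier runs count with full weight and pairs of later runs not at all, so
only the run through `x` has to be estimated. -/
theorem rowExcess_nonneg (h : ColumnPairs E a b σ r) {T : Finset ι} (hT : T ⊆ E)
    (hbal : IsBalanced (columnWeight a b) (columnIndex a b σ) T) (x : ℕ) :
    0 ≤ rowExcess a b T x := by
  have hlow : ∀ k ∈ E, columnIndex a b σ k < runStart σ x → max (a k) (b k) ≤ x := by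
    intro k hk hlt
    by_contra hx
    rcases le_or_gt (min (a k) (b k)) x with h1 | h1
    · exact hlt.ne' (h.runStart_eq hk h1 (not_le.1 hx))
    · exact hlt.not_ge (runStart_mono σ h1.le)
  have hhigh : ∀ k, runStart σ x < columnIndex a b σ k → x ≤ min (a k) (b k) := by
    intro k hlt
    by_contra hx
    exact hlt.not_ge (runStart_mono σ (not_le.1 hx).le)
  -- In a negative run, cutting at `x` keeps at most part of each negative weight, so the prefix
  -- including the run is a lower bound; otherwise the run contributes nonnegatively and the prefix
  -- before it is one.
  by_cases hσ : σ x = -1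
  · refine (hbal.2 (runStart σ x + 1)).trans (Finset.sum_le_sum fun k hk => ?_)
    split_ifs with h1
    · rw [columnWeight]
      rcases (Nat.lt_succ_iff.1 h1).lt_or_eq with h2 | h2
      · have := hlow k (hT hk) h2
        omega
      · have h3 := h.sign_columnIndex (hT hk)
        rw [h2, apply_runStart σ, hσ] at h3
        split_ifs at h3 with h4
        omega
    · have := hhigh k (by omega)
      omega
  · refine (hbal.2 (runStart σ x)).trans (Finset.sum_le_sum fun k hk => ?_)
    split_ifs with h1
    · rw [columnWeight]
      have := hlow k (hT hk) h1
      omega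
    · rcases (not_lt.1 h1).lt_or_eq with h2 | h2
      · have := hhigh k h2
        omega
      · have h3 := h.sign_columnIndex (hT hk)
        rw [← h2, apply_runStart σ] at h3
        split_ifs at h3 with h4
        · omega
        · exact absurd h3 hσ

/-- At a row where a run begins no pair is cut, so the row excess there is exactly a prefix sum. -/
theorem prefixSum_nonneg (h : ColumnPairs E a b σ r) (hE : ∀ x, x ≤ r → 0 ≤ rowExcess a b E x)
    (i : ℕ) : 0 ≤ prefixSum (columnWeight a b) (columnIndex a b σ) i E := by
  have key : ∀ y, y ≤ r → (∀ k ∈ E, columnIndex a b σ k < i → max (a k) (b k) ≤ y) →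
      (∀ k ∈ E, i ≤ columnIndex a b σ k → y ≤ min (a k) (b k)) →
      0 ≤ prefixSum (columnWeight a b) (columnIndex a b σ) i E := by
    intro y hy h1 h2
    refine (hE y hy).trans_eq (Finset.sum_congr rfl fun k hk => ?_)
    split_ifs with h3
    · have := h1 k hk h3
      rw [columnWeight]
      omega
    · have := h2 k hk (not_lt.1 h3)
      omega
  -- The row used is the first run start from `i` on, or `r` if there is none.
  by_cases hex : ∃ y, y ≤ r ∧ i ≤ y ∧ runStart σ y = y
  · obtain ⟨h1, h2, h3⟩ := Nat.find_spec hex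
    refine key _ h1 (fun k hk hlt => ?_) fun k hk hle => ?_
    · by_contra hmax
      have h4 := h.min_lt_max hk
      have h5 := runStart_mono σ (Nat.le_sub_one_of_lt (not_le.1 hmax))
      rw [h.runStart_eq hk (Nat.le_sub_one_of_lt h4) (by omega)] at h5
      omega
    · exact (Nat.find_min' hex ⟨(h.columnIndex_lt hk).le, hle, runStart_runStart σ _⟩).trans
        (runStart_le σ _)
  · refine key r le_rfl (fun k hk _ => max_le (h.le_left k hk) (h.le_right k hk))
      fun k hk hle => ?_
    exact absurd ⟨_, (h.columnIndex_lt hk).le, hle, runStart_runStart σ _⟩ hex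

theorem irreducibleSystem [DecidableEq ι] (h : ColumnPairs E a b σ r)
    (hE : ∀ x, x ≤ r → 0 ≤ rowExcess a b E x) (hsum : ∑ k ∈ E, columnWeight a b k = 0)
    (hirr : ∀ T ⊆ E, ∑ k ∈ T, columnWeight a b k = 0 → (∀ x, x ≤ r → 0 ≤ rowExcess a b T x) →
      (∀ x, x ≤ r → 0 ≤ rowExcess a b (E \ T) x) → T = ∅ ∨ T = E) :
    IrreducibleSystem E (columnWeight a b) (columnIndex a b σ) (fun i => σ i = 1)
      (fun i => (signRun σ r i).card) r where
  idx_lt k hk := h.columnIndex_lt hk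
  balanced := ⟨hsum, h.prefixSum_nonneg hE⟩
  irreducible T hT h1 h2 := hirr T hT h1.1 (fun x _ => h.rowExcess_nonneg hT h1 x)
    fun x _ => h.rowExcess_nonneg Finset.sdiff_subset h2 x
  weight_pos k hk hpos := by
    rw [h.sign_columnIndex hk] at hpos
    split_ifs at hpos with hab
    rw [columnWeight]
    omega
  weight_neg k hk hneg := by
    have := h.ne k hk
    rw [h.sign_columnIndex hk] at hneg
    split_ifs at hneg with hab
    · exact absurd rfl hneg
    · rw [columnWeight]
      omega
  weight_le k hk := (h.abs_columnWeight_le hk).trans (by omega)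
  exists_weight_le k hk _ := ⟨k, hk, rfl, (le_abs_self _).trans (h.abs_columnWeight_le hk)⟩

/-- The number of column pairs of an irreducible pair of partitions with `r` rows is at most `r`,
with equality only for pairs of rectangles. -/
theorem card_le [DecidableEq ι] (h : ColumnPairs E a b σ r) (hne : E.Nonempty)
    (hsys : IrreducibleSystem E (columnWeight a b) (columnIndex a b σ) (fun i => σ i = 1)
      (fun i => (signRun σ r i).card) r)
    (hcover : ∀ x, x < r → σ x ≠ 0 → ∃ k ∈ E, min (a k) (b k) ≤ x ∧ x < max (a k) (b k))
    (h0 : σ 0 ≠ -1) :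
    E.card ≤ r ∧ (E.card = r → ∃ α, ∀ k ∈ E, a k = α ∧ (b k = 0 ∨ b k = r)) := by
  have hle : ∀ k ∈ E, |columnWeight a b k| ≤ (signRun σ r (columnIndex a b σ k)).card :=
    fun k hk => h.abs_columnWeight_le hk
  have hsum := hsys.balanced.1
  have hw0 : ∀ k ∈ E, columnWeight a b k ≠ 0 := fun k hk => by
    have := h.ne k hk
    rw [columnWeight]
    omega
  obtain ⟨n, hn, hneg⟩ : ∃ k ∈ E, columnWeight a b k < 0 := by
    by_contra! hcon
    exact (Finset.sum_pos (fun k hk => (hcon k hk).lt_of_ne' (hw0 k hk)) hne).ne' hsum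
  obtain ⟨p, hp, hpos⟩ : ∃ k ∈ E, 0 < columnWeight a b k := by
    by_contra! hcon
    exact (Finset.sum_neg (fun k hk => (hcon k hk).lt_of_ne (hw0 k hk)) hne).ne hsum
  obtain ⟨hcard, hcard'⟩ := hsys.card_le_sum hle hn hneg
  have htot := sum_card_signRun σ r
  have hfil : ((Finset.range r).filter fun x => σ x ≠ 0).card ≤ r := by
    simpa using Finset.card_filter_le (Finset.range r) fun x => σ x ≠ 0
  refine ⟨by omega, fun heq => ?_⟩
  have heq' : E.card = ∑ i ∈ Finset.range r, (signRun σ r i).card := by omega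
  obtain ⟨hnidx, hpw⟩ := hcard' heq'
  obtain ⟨hpidx, hnw⟩ := hsys.eq_of_card_eq_sum hle hp hpos heq'
  have hσ : ∀ x, x < r → σ x ≠ 0 := by
    have h1 := Finset.card_filter_eq_iff.1
      (show ((Finset.range r).filter fun x => σ x ≠ 0).card = (Finset.range r).card by
        rw [Finset.card_range]
        omega)
    exact fun x hx => h1 x (Finset.mem_range.2 hx)
  -- Weights of maximal size: each pair spans its entire run.
  have hIco : ∀ k ∈ E, Finset.Ico (min (a k) (b k)) (max (a k) (b k)) =
      signRun σ r (columnIndex a b σ k) := fun k hk => by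
    refine Finset.eq_of_subset_of_card_le (h.Ico_subset_signRun hk) ?_
    have h1 := card_Ico (a := a) (b := b) k
    rcases (hw0 k hk).lt_or_gt with h2 | h2
    · have := hnw k hk h2
      rw [abs_of_neg h2] at h1
      omega
    · have := hpw k hk h2
      rw [abs_of_pos h2] at h1
      omega
  have hends : ∀ k ∈ E, ∀ k' ∈ E, columnIndex a b σ k = columnIndex a b σ k' →
      min (a k) (b k) = min (a k') (b k') ∧ max (a k) (b k) = max (a k') (b k') := by
    intro k hk k' hk' hkk
    have h1 : Finset.Ico (min (a k) (b k)) (max (a k) (b k)) =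
      Finset.Ico (min (a k') (b k')) (max (a k') (b k')) := by rw [hIco k hk, hIco k' hk', hkk]
    have hm := h.min_lt_max hk
    have hm' := h.min_lt_max hk'
    have h2 := fun x => Finset.ext_iff.1 h1 x
    simp only [Finset.mem_Ico] at h2
    have e1 := h2 (min (a k) (b k))
    have e2 := h2 (min (a k') (b k'))
    have e3 := h2 (max (a k) (b k) - 1)
    have e4 := h2 (max (a k') (b k') - 1)
    omega
  simp only [columnWeight] at hneg hpos hpidx hnidx
  have hposEnds : ∀ k ∈ E, b k < a k → a k = a p ∧ b k = b p := fun k hk hab => by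
    have := hends k hk p hp (hpidx k hk (by omega))
    omega
  have hnegEnds : ∀ k ∈ E, a k < b k → a k = a n ∧ b k = b n := fun k hk hab => by
    have := hends k hk n hn (hnidx k hk (by omega))
    omega
  have hcov : ∀ x, x < r → (b p ≤ x ∧ x < a p) ∨ (a n ≤ x ∧ x < b n) := fun x hx => by
    obtain ⟨k, hk, h1, h2⟩ := hcover x hx (hσ x hx)
    rcases (h.ne k hk).lt_or_gt with h3 | h3
    · have := hnegEnds k hk h3
      omega
    · have := hposEnds k hk h3
      omega
  have hdis : ∀ x, b p ≤ x → x < a p → a n ≤ x → x < b n → False := fun x h1 h2 h3 h4 => by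
    have h5 := h.sign_pos p hp x h1 h2
    rw [h.sign_neg n hn x h3 h4] at h5
    exact absurd h5 (by decide)
  have hp_le := h.le_left p hp
  have hn_le := h.le_right n hn
  -- The two intervals tile `[0, r)`, and the sign at row `0` puts the positive one first.
  have han : a n ≠ 0 := fun h1 => h0 (h.sign_neg n hn 0 h1.le (by omega))
  have hbp : b p = 0 := by
    have := hcov 0 (by omega)
    omega
  have hle : a p ≤ a n := by
    by_contra hlt
    exact hdis (a n) (by omega) (by omega) le_rfl (by omega)
  have hap : a n = a p := by
    have := hcov (a p) (by omega)
    omega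
  have hbn : b n = r := by
    have := hcov (r - 1) (by omega)
    omega
  refine ⟨a p, fun k hk => ?_⟩
  rcases (h.ne k hk).lt_or_gt with h3 | h3
  · have := hnegEnds k hk h3
    omega
  · have := hposEnds k hk h3
    omega

end ColumnPairs

/-! ### From Hilbert basis elements to column pairs -/

/-- A row `x` between the two heights has a cell of column `k` in exactly one of the partitions, so
`k` separates `lam x` from `mu x` and fixes the sign. -/
theorem columnPairs_of_antitone {r n : ℕ} {lam mu : Fin r → ℤ} (hlam : Antitone lam)
    (hmu : Antitone mu)
    (hne : ∀ k ∈ Finset.range n, columnHeight lam k ≠ columnHeight mu k) :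
    ColumnPairs (Finset.range n) (columnHeight lam) (columnHeight mu)
      (fun x => if h : x < r then SignType.sign (lam ⟨x, h⟩ - mu ⟨x, h⟩) else 0) r where
  le_left k _ := columnHeight_le lam k
  le_right k _ := columnHeight_le mu k
  ne := hne
  sign_pos k _ x h1 h2 := by
    have hx : x < r := h2.trans_le (columnHeight_le lam k)
    have h3 := (lt_columnHeight_iff hlam k ⟨x, hx⟩).1 h2
    have h4 := (lt_columnHeight_iff hmu k ⟨x, hx⟩).not.1 h1.not_gt
    rw [dif_pos hx]
    exact sign_pos (by omega)
  sign_neg k _ x h1 h2 := by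
    have hx : x < r := h2.trans_le (columnHeight_le mu k)
    have h3 := (lt_columnHeight_iff hmu k ⟨x, hx⟩).1 h2
    have h4 := (lt_columnHeight_iff hlam k ⟨x, hx⟩).not.1 h1.not_gt
    rw [dif_pos hx]
    exact sign_neg (by omega)

theorem isRectangle_ofColumns {ι : Type*} {r α : ℕ} {a : ι → ℕ} {T : Finset ι}
    (h : ∀ k ∈ T, a k = 0 ∨ a k = α) : IsRectangle (ofColumns r a T) := by
  have key : ∀ i, ofColumns r a T i ≠ 0 →
      ofColumns r a T i = (T.filter fun k => a k = α).card := by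
    intro i hi
    have hiα : (i : ℕ) < α := by
      by_contra hcon
      refine hi ?_
      rw [ofColumns, Finset.filter_eq_empty_iff.2 fun k hk hlt => ?_]
      · simp
      · rcases h k hk with h1 | h1 <;> omega
    rw [ofColumns]
    congr 2
    refine Finset.filter_congr fun k hk => ?_
    rcases h k hk with h1 | h1 <;> omega
  intro i j hi hj
  rw [key i hi, key j hj]

theorem theorem1p3 (r : ℕ) (hr : 0 < r) (lam mu : Fin r → ℤ)
    (h : (lam, mu) ∈ hilbertBasis (kostkaSemigroup r)) :
    lam ⟨0, hr⟩ ≤ (r : ℤ) ∧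
      (lam ⟨0, hr⟩ = (r : ℤ) → IsRectangle lam ∧ IsRectangle mu) := by
  obtain ⟨hmem, hne, hirr⟩ := h
  obtain ⟨hlam, hlam0, hmu, hmu0, hdom, hsum⟩ := mem_kostkaSemigroup_iff.1 hmem
  dsimp only at hlam hlam0 hmu hmu0 hdom hsum
  obtain ⟨n, hn⟩ : ∃ n : ℕ, lam ⟨0, hr⟩ = n := ⟨_, (Int.toNat_of_nonneg (hlam0 _)).symm⟩
  have hfirst : ∀ x : Fin r, (⟨0, hr⟩ : Fin r) ≤ x := fun x => Nat.zero_le _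
  have hlamn : ∀ x, lam x ≤ n := fun x => hn ▸ hlam (hfirst x)
  have hmulam : mu ⟨0, hr⟩ ≤ lam ⟨0, hr⟩ := by
    have h1 : Finset.Iic (⟨0, hr⟩ : Fin r) = {⟨0, hr⟩} := by
      ext x
      simp [Fin.ext_iff, Fin.le_def]
    simpa [h1] using hdom ⟨0, hr⟩
  have hmun : ∀ x, mu x ≤ n := fun x => (hmu (hfirst x)).trans (hn ▸ hmulam)
  set a := columnHeight lam with ha
  set b := columnHeight mu with hb
  set E := Finset.range n with hEdef
  have hlamE : ofColumns r a E = lam := ofColumns_columnHeight hlam hlam0 hlamn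
  have hmuE : ofColumns r b E = mu := ofColumns_columnHeight hmu hmu0 hmun
  have hapos : ∀ k ∈ E, 0 < a k := fun k hk => by
    refine (lt_columnHeight_iff hlam k ⟨0, hr⟩).2 ?_
    rw [hn]
    exact_mod_cast Finset.mem_range.1 hk
  have har : ∀ k, a k ≤ r := columnHeight_le lam
  have hbr : ∀ k, b k ≤ r := columnHeight_le mu
  have hEsum : ∑ k ∈ E, columnWeight a b k = 0 := by
    simp only [columnWeight]
    rw [Finset.sum_sub_distrib, ← sum_ofColumns fun k _ => har k,
      ← sum_ofColumns fun k _ => hbr k, hlamE, hmuE, hsum, sub_self]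
  have hEexc : ∀ x, x ≤ r → 0 ≤ rowExcess a b E x := by
    intro x hx
    cases x with
    | zero => simp [rowExcess]
    | succ x =>
      have h1 := hdom ⟨x, hx⟩
      rw [← hlamE, ← hmuE, sum_Iic_ofColumns, sum_Iic_ofColumns] at h1
      rw [rowExcess, Finset.sum_sub_distrib]
      exact sub_nonneg.2 h1
  have hnonzero : ∀ T ⊆ E, T.Nonempty → (ofColumns r a T, ofColumns r b T) ≠ 0 := by
    rintro T hT ⟨k, hk⟩ h0
    have h1 : ofColumns r a T ⟨0, hr⟩ = 0 := congrFun (congrArg Prod.fst h0) _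
    rw [ofColumns, Nat.cast_eq_zero, Finset.card_eq_zero] at h1
    exact Finset.notMem_empty k (h1 ▸ Finset.mem_filter.2 ⟨hk, hapos k (hT hk)⟩)
  have hsplit : ∀ T ⊆ E, ∑ k ∈ T, columnWeight a b k = 0 →
      (∀ x, x ≤ r → 0 ≤ rowExcess a b T x) → (∀ x, x ≤ r → 0 ≤ rowExcess a b (E \ T) x) → T = ∅ ∨ T = E := by
    intro T hT h1 h2 h3
    by_contra! hcon
    refine hirr ⟨_, ofColumns_mem (fun k _ => har k) (fun k _ => hbr k) h2 h1,
      _, ofColumns_mem (T := E \ T) (fun k _ => har k) (fun k _ => hbr k) h3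
        ((weightSum_sdiff hT).trans ?_), hnonzero T hT hcon.1, hnonzero _ Finset.sdiff_subset ?_, ?_⟩
    · exact sub_eq_zero.2 (hEsum.trans h1.symm)
    · exact Finset.sdiff_nonempty.2 fun h4 => hcon.2 (hT.antisymm h4)
    · rw [Prod.mk_add_mk, ofColumns_add_sdiff r a hT, ofColumns_add_sdiff r b hT, hlamE, hmuE]
  have hEne : E.Nonempty := by
    by_contra h0
    rw [Finset.not_nonempty_iff_eq_empty] at h0
    refine hne ?_
    rw [← hlamE, ← hmuE, h0]
    rfl
  rw [hn, Nat.cast_le, Nat.cast_inj]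
  by_cases hab : ∀ k ∈ E, a k ≠ b k
  · have hcp := columnPairs_of_antitone hlam hmu hab
    have hfin := hcp.card_le hEne (hcp.irreducibleSystem hEexc hEsum hsplit) (fun x hx hσ => ?_) ?_
    · rw [Finset.card_range] at hfin
      refine ⟨hfin.1, fun hnr => ?_⟩
      obtain ⟨α, hα⟩ := hfin.2 hnr
      rw [← hlamE, ← hmuE]
      exact ⟨isRectangle_ofColumns fun k hk => Or.inr (hα k hk).1,
        isRectangle_ofColumns fun k hk => (hα k hk).2⟩
    · rw [dif_pos hx, Ne, sign_eq_zero_iff, sub_eq_zero] at hσ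
      have hl0 := hlam0 ⟨x, hx⟩
      have hm0 := hmu0 ⟨x, hx⟩
      have hln := hlamn ⟨x, hx⟩
      have hmn := hmun ⟨x, hx⟩
      -- This is the first column that meets row `x` in only one of the two partitions.
      have key : ∀ k : ℕ, (k : ℤ) = min (lam ⟨x, hx⟩) (mu ⟨x, hx⟩) →
          min (a k) (b k) ≤ x ∧ x < max (a k) (b k) := by
        intro k hk
        have h1 := lt_columnHeight_iff hlam k ⟨x, hx⟩
        have h2 := lt_columnHeight_iff hmu k ⟨x, hx⟩
        rw [← ha] at h1
        rw [← hb] at h2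
        dsimp only at h1 h2
        omega
      refine ⟨(min (lam ⟨x, hx⟩) (mu ⟨x, hx⟩)).toNat, Finset.mem_range.2 (by omega),
        key _ (Int.toNat_of_nonneg (by omega))⟩
    · rw [dif_pos hr]
      rw [← sub_nonneg] at hmulam
      rcases hmulam.eq_or_lt with h1 | h1
      · rw [← h1, sign_zero]
        decide
      · rw [sign_pos h1]
        decide
  -- A pair of equal columns has zero weight and zero excess in every row, so it splits off;
  -- irreducibility leaves `E = {k}`, hence `n = 1`.
  · push Not at hab
    obtain ⟨k, hk, hkab⟩ := hab
    have h1 := hsplit {k} (Finset.singleton_subset_iff.2 hk) (by simp [columnWeight, hkab])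
      (fun x _ => by simp [rowExcess, hkab]) (fun x hx => ?_)
    · have h2 := congrArg Finset.card (h1.resolve_left (Finset.singleton_ne_empty k))
      rw [Finset.card_singleton, Finset.card_range] at h2
      refine ⟨by omega, fun hnr => ?_⟩
      have hsub : ∀ i j : Fin r, i = j := fun i j => Fin.ext (by omega)
      exact ⟨fun i j _ _ => by rw [hsub i j], fun i j _ _ => by rw [hsub i j]⟩
    · refine (hEexc x hx).trans_eq ?_
      rw [rowExcess, rowExcess, ← Finset.sum_sdiff (Finset.singleton_subset_iff.2 hk),
        Finset.sum_singleton, hkab, sub_self, add_zero]
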